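/- Let $G$ and $H$ be real Lie groups that are finite-dimensional (or, more generally, modelled on reflexive Banach spaces), with Lie algebras $\mathfrak g=T_{e_G}G$ and $\mathfrak h=T_{e_H}H$ (brackets of left-invariant vector fields). Let $(G,H)$ be a matched pair of Lie groups: there are a smooth left action $\rho:(h,g)\mapsto h\vartriangleright g$ of $H$ on $G$ and a smooth right action $\sigma:(h,g)\mapsto h\vartriangleleft g$ of $G$ on $H$ with $$h\vartriangleright(g_1g_2)=(h\vartriangleright g_1)\big((h\vartriangleleft g_1)\vartriangleright g_2\big),\quad (h_1h_2)\vartriangleleft g=\big(h_1\vartriangleleft(h_2\vartriangleright g)\big)(h_2\vartriangleleft g),\quad h\vartriangleright e_G=e_G,\quad e_H\vartriangleleft g=e_H,$$ and let $G\bowtie H$ be the Lie group $G\times H$ with product $(g_1,h_1)(g_2,h_2)=(g_1(h_1\vartriangleright g_2),(h_1\vartriangleleft g_2)h_2)$. Write $R$ for right translations and $\rho_g(h)=\rho_h(g)=h\vartriangleright g$, $\sigma_g(h)=h\vartriangleleft g$. For $\xi\in\mathfrak g$, $\eta\in\mathfrak h$ put $h\vartriangleright\xi=T_{e_G}\rho_h\,\xi\in\mathfrak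 g$ and $\eta\vartriangleleft g=T_{e_H}\sigma_g\,\eta\in\mathfrak h$, let $\eta\vartriangleright\xi\in\mathfrak g$ be the derivative of $h\mapsto h\vartriangleright\xi$ at $e_H$ in the direction $\eta$, and let $\eta\vartriangleleft\xi\in\mathfrak h$ be the derivative of $g\mapsto\eta\vartriangleleft g$ at $e_G$ in the direction $\xi$. Dually, for $\nu\in\mathfrak h^*$, let $\langle g\overset{*}{\vartriangleright}\nu,\eta\rangle=\langle\nu,\eta\vartriangleleft g\rangle$ and $\langle\xi\overset{*}{\vartriangleright}\nu,\eta\rangle=\langle\nu,\eta\vartriangleleft\xi\rangle$. For $(\xi_i,\eta_i)\in\mathfrak g\oplus\mathfrak h$ let $$[(\xi_1,\eta_1),(\xi_2,\eta_2)]=\big([\xi_1,\xi_2]+\eta_1\vartriangleright\xi_2-\eta_2\vartriangleright\xi_1,\ [\eta_1,\eta_2]+\eta_1\vartriangleleft\xi_2-\eta_2\vartriangleleft\xi_1\big),$$ and let $\langle ad^*_x\alpha,y\rangle=-\langle\alpha,[x,y]\rangle$. Identify $T^*(G\bowtie H)$ with $P=(\mathfrak g^*\oplus\mathfrak h^*)\times(G\bowtie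 H)$ by right trivialization $\alpha_k\mapsto(\alpha_k\circ T_eR_k,k)$, let $\theta$ be the canonical one-form on $P$, $\Omega=-d\theta$ the canonical symplectic form, $X_{\mathcal H}$ the Hamiltonian vector field of $\mathcal H$ ($i_{X_{\mathcal H}}\Omega=d\mathcal H$), and $\{\mathcal H,\mathcal F\}=\Omega(X_{\mathcal H},X_{\mathcal F})$ the canonical Poisson bracket; the canonical Poisson bracket on $\mathfrak g^*\rtimes G\cong T^*G$ is defined in the same way. Then: (i) At every point of $P$ the map $X\mapsto\Omega(X,\cdot)$ is a bijection from tangent vectors to (continuous) covectors, and on the right invariant vector fields $X_{(\hat\mu,\hat\nu,\xi,\eta)}(\mu,\nu,g,h)=\big((\hat\mu,\hat\nu)+ad^*_{(\xi,\eta)}(\mu,\nu),\,TR_{(g,h)}(\xi,\eta)\big)$ it takes the values $$\Omega(X_{(\hat\mu_1,\hat\nu_1,\xi_1,\eta_1)},X_{(\hat\mu_2,\hat\nu_2,\xi_2,\eta_2)})=\langle(\hat\mu_2,\hat\nu_2),(\xi_1,\eta_1)\rangle-\langle(\hat\mu_1,\hat\nu_1),(\xi_2,\eta_2)\rangle+\langle(\mu,\nu),[(\xi_1,\eta_1),(\xi_2,\eta_2)]\rangle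 .$$ (ii) For all functions $\mathcal H,\mathcal F$ on $P$ that are differentiable at $(\mu,\nu,g,h)$ (in particular for all smooth functions), with partial derivatives $\frac{\delta\mathcal H}{\delta\mu}\in\mathfrak g$, $\frac{\delta\mathcal H}{\delta\nu}\in\mathfrak h$, $\frac{\delta\mathcal H}{\delta g}\in T_g^*G$, $\frac{\delta\mathcal H}{\delta h}\in T_h^*H$, and with $T^*R_g(\alpha)=\alpha\circ T_{e_G}R_g$, $T^*\rho_g(\alpha)=\alpha\circ T_{e_H}\rho_g$, $T^*R_h(\beta)=\beta\circ T_{e_H}R_h$, one has $\{\mathcal H,\mathcal F\}(\mu,\nu,g,h)=K+L+M_1+M_2+N$, where $$K=\Big\langle T^*R_g\Big(\tfrac{\delta\mathcal H}{\delta g}\Big),\tfrac{\delta\mathcal F}{\delta\mu}\Big\rangle-\Big\langle T^*R_g\Big(\tfrac{\delta\mathcal F}{\delta g}\Big),\tfrac{\delta\mathcal H}{\delta\mu}\Big\rangle+\Big\langle\mu,\Big[\tfrac{\delta\mathcal H}{\delta\mu},\tfrac{\delta\mathcal F}{\delta\mu}\Big]\Big\rangle,$$ $$L=\Big\langle T^*\rho_g\Big(\tfrac{\delta\mathcal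 H}{\delta g}\Big),\tfrac{\delta\mathcal F}{\delta\nu}\Big\rangle-\Big\langle T^*\rho_g\Big(\tfrac{\delta\mathcal F}{\delta g}\Big),\tfrac{\delta\mathcal H}{\delta\nu}\Big\rangle+\Big\langle\nu,\Big[\tfrac{\delta\mathcal H}{\delta\nu},\tfrac{\delta\mathcal F}{\delta\nu}\Big]\Big\rangle,$$ $$M_1=\Big\langle g\overset{*}{\vartriangleright}T^*R_h\Big(\tfrac{\delta\mathcal H}{\delta h}\Big),\tfrac{\delta\mathcal F}{\delta\nu}\Big\rangle-\Big\langle g\overset{*}{\vartriangleright}T^*R_h\Big(\tfrac{\delta\mathcal F}{\delta h}\Big),\tfrac{\delta\mathcal H}{\delta\nu}\Big\rangle,$$ $$M_2=-\Big\langle\tfrac{\delta\mathcal H}{\delta\mu}\overset{*}{\vartriangleright}\nu,\tfrac{\delta\mathcal F}{\delta\nu}\Big\rangle+\Big\langle\tfrac{\delta\mathcal F}{\delta\mu}\overset{*}{\vartriangleright}\nu,\tfrac{\delta\mathcal H}{\delta\nu}\Big\rangle,$$ $$N=\Big\langle\mu,\tfrac{\delta\mathcal H}{\delta\nu}\vartriangleright\tfrac{\delta\mathcal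 F}{\delta\mu}\Big\rangle-\Big\langle\mu,\tfrac{\delta\mathcal F}{\delta\nu}\vartriangleright\tfrac{\delta\mathcal H}{\delta\mu}\Big\rangle .$$ (iii) $K$ is the canonical Poisson bracket on $\mathfrak g^*\rtimes G$, at $(\mu,g)$, of the functions obtained from $\mathcal H,\mathcal F$ by freezing $\nu$ and $h$; and $L$ is the Poisson bracket on $\mathfrak h^*\rtimes G$, at $(\nu,g)$, of the functions obtained by freezing $\mu$ and $h$, i.e. the value at $(\mu,\nu,g,h)$ of the canonical bracket on $P$ of these functions pulled back along $(\mu,\nu,g,h)\mapsto(\nu,g)$. -/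

import Mathlib

open scoped Manifold ContDiff
open NormedSpace (inclusionInDoubleDual)

noncomputable section

/-! ### Exterior derivative of a one-form on a manifold -/

section OneForm

variable {W : Type*} [NormedAddCommGroup W] [NormedSpace ℝ W] {S : Type*} [TopologicalSpace S]
  {J : ModelWithCorners ℝ W S} {N : Type*} [TopologicalSpace N] [ChartedSpace S N]

/-- The one-form `θ` read in the preferred chart at `p`, i.e. its pull-back under the inverse of
the chart: a map from the model space `W` to covectors on `W`. -/
def oneFormInChart (θ : ∀ q : N, TangentSpace J q →L[ℝ] ℝ) (p : N) (y : W) : W →L[ℝ] ℝ :=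
  (θ ((extChartAt J p).symm y)).comp
    (mfderivWithin 𝓘(ℝ, W) J (extChartAt J p).symm (Set.range J) y)

/-- The exterior derivative of a one-form `θ`, computed in the preferred chart at `p`:
`dθ(v, w) = (D_v θ)(w) - (D_w θ)(v)`. -/
def extDerivOneForm (θ : ∀ q : N, TangentSpace J q →L[ℝ] ℝ) (p : N)
    (v w : TangentSpace J p) : ℝ :=
  let T : TangentSpace J p →L[ℝ] W := mfderiv J 𝓘(ℝ, W) (extChartAt J p) p
  let D : W →L[ℝ] W →L[ℝ] ℝ :=
    fderivWithin ℝ (oneFormInChart θ p) (Set.range J) (extChartAt J p p)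
  D (T v) (T w) - D (T w) (T v)

end OneForm

/-! ### The right-trivialized cotangent bundle of a Lie group

For a Lie group `K` with Lie algebra `𝔨 = T_1 K` (modelled on `V`), the cotangent bundle `T^*K` is
identified with `𝔨^* × K` by `α_k ↦ (α_k ∘ T_1 R_k, k)`.  -/

section Cotangent

variable {V : Type*} [NormedAddCommGroup V] [NormedSpace ℝ V] {S : Type*} [TopologicalSpace S]
  (I : ModelWithCorners ℝ V S) (K : Type*) [TopologicalSpace K] [ChartedSpace S K] [Group K]

/-- The right-trivialized cotangent bundle `𝔨^* × K`. -/
abbrev TrivCotangent : Type _ := StrongDual ℝ V × K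

/-- The model with corners of the manifold `𝔨^* × K`. -/
abbrev cotangentModel :
    ModelWithCorners ℝ (StrongDual ℝ V × V) (ModelProd (StrongDual ℝ V) S) :=
  𝓘(ℝ, StrongDual ℝ V).prod I

variable {K}

/-- `T_1 R_k : 𝔨 → T_k K`, the tangent map at `1` of the right translation `R_k x = x k`. -/
def tangentRight (k : K) : V →L[ℝ] V :=
  (mfderiv I I (fun x : K => x * k) 1 : TangentSpace I (1 : K) →L[ℝ] TangentSpace I (1 * k))

/-- The covector in `T_k^* K` that corresponds to `(μ, k)` under the right trivialization, namely
`μ ∘ T_k R_{k⁻¹}`. -/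
def covectorOf (p : TrivCotangent (V := V) K) : TangentSpace I p.2 →L[ℝ] ℝ :=
  p.1.comp (mfderiv I I (fun x : K => x * p.2⁻¹) p.2 :
    TangentSpace I p.2 →L[ℝ] TangentSpace I (p.2 * p.2⁻¹))

/-- The canonical (tautological) one-form `θ_α(v) = α (Tπ v)` of the cotangent bundle, transported
to `𝔨^* × K` by the right trivialization. -/
def canonicalOneForm (p : TrivCotangent (V := V) K) :
    TangentSpace (cotangentModel I) p →L[ℝ] ℝ :=
  (covectorOf I p).comp (mfderiv (cotangentModel I) I Prod.snd p)

/-- The canonical symplectic two-form `Ω = -dθ`. -/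
def canonicalTwoForm (p : TrivCotangent (V := V) K) (v w : TangentSpace (cotangentModel I) p) :
    ℝ :=
  -extDerivOneForm (J := cotangentModel I) (canonicalOneForm I) p v w

/-- `X` is the value at `p` of the Hamiltonian vector field of `f`: `Ω(X, ·) = df` at `p`. -/
def IsHamiltonianVector (f : TrivCotangent (V := V) K → ℝ) (p : TrivCotangent (V := V) K)
    (X : TangentSpace (cotangentModel I) p) : Prop :=
  ∀ w : TangentSpace (cotangentModel I) p,
    canonicalTwoForm I p X w = mfderiv (cotangentModel I) 𝓘(ℝ, ℝ) f p w

/-- The Hamiltonian vector of `f` at `p` (meaningful where `IsHamiltonianVector` has exactly one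
solution). -/
def hamiltonianVector (f : TrivCotangent (V := V) K → ℝ) (p : TrivCotangent (V := V) K) :
    TangentSpace (cotangentModel I) p :=
  Classical.epsilon (IsHamiltonianVector I f p)

/-- The canonical Poisson bracket `{f₁, f₂} = Ω(X_{f₁}, X_{f₂})`. -/
def canonicalPoisson (f₁ f₂ : TrivCotangent (V := V) K → ℝ) (p : TrivCotangent (V := V) K) : ℝ :=
  canonicalTwoForm I p (hamiltonianVector I f₁ p) (hamiltonianVector I f₂ p)

end Cotangent

/-- The functional derivative `δf/δμ` of a function on a dual space `V^*`, as an element of `V`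
(for reflexive `V`): `⟨μ̂, δf/δμ⟩ = Df(μ) μ̂`. -/
def functionalDeriv {V : Type*} [NormedAddCommGroup V] [NormedSpace ℝ V]
    (f : StrongDual ℝ V → ℝ) (μ : StrongDual ℝ V) : V :=
  Function.invFun (inclusionInDoubleDual ℝ V) (fderiv ℝ f μ)

/-! ### Matched pairs of Lie groups -/

/-- A matched pair of Lie groups: a smooth left action `ρ h g = h ▷ g` of `H` on `G` and a smooth
right action `σ h g = h ◁ g` of `G` on `H` that satisfy the compatibility conditions. -/
structure MatchedPair {E F : Type*} [NormedAddCommGroup E] [NormedSpace ℝ E]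
    [NormedAddCommGroup F] [NormedSpace ℝ F]
    (G : Type*) [TopologicalSpace G] [ChartedSpace E G] [Group G] [LieGroup 𝓘(ℝ, E) ∞ G]
    (H : Type*) [TopologicalSpace H] [ChartedSpace F H] [Group H] [LieGroup 𝓘(ℝ, F) ∞ H] where
  ρ : H → G → G
  σ : H → G → H
  contMDiff_ρ : ContMDiff (𝓘(ℝ, F).prod 𝓘(ℝ, E)) 𝓘(ℝ, E) ∞ (fun x : H × G => ρ x.1 x.2)
  contMDiff_σ : ContMDiff (𝓘(ℝ, F).prod 𝓘(ℝ, E)) 𝓘(ℝ, F) ∞ (fun x : H × G => σ x.1 x.2)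
  one_ρ : ∀ g, ρ 1 g = g
  mul_ρ : ∀ h₁ h₂ g, ρ (h₁ * h₂) g = ρ h₁ (ρ h₂ g)
  σ_one : ∀ h, σ h 1 = h
  σ_mul : ∀ h g₁ g₂, σ h (g₁ * g₂) = σ (σ h g₁) g₂
  ρ_mul : ∀ h g₁ g₂, ρ h (g₁ * g₂) = ρ h g₁ * ρ (σ h g₁) g₂
  mul_σ : ∀ h₁ h₂ g, σ (h₁ * h₂) g = σ h₁ (ρ h₂ g) * σ h₂ g
  ρ_one : ∀ h, ρ h 1 = 1
  one_σ : ∀ g, σ 1 g = 1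

namespace MatchedPair

variable {E F : Type*} [NormedAddCommGroup E] [NormedSpace ℝ E]
  [NormedAddCommGroup F] [NormedSpace ℝ F]
  {G : Type*} [TopologicalSpace G] [ChartedSpace E G] [Group G] [LieGroup 𝓘(ℝ, E) ∞ G]
  {H : Type*} [TopologicalSpace H] [ChartedSpace F H] [Group H] [LieGroup 𝓘(ℝ, F) ∞ H]

/-- The matched pair group `G ⋈ H`: the manifold `G × H` with the multiplication
`(g₁, h₁) (g₂, h₂) = (g₁ (h₁ ▷ g₂), (h₁ ◁ g₂) h₂)`. -/
def Bowtie (_M : MatchedPair (E := E) (F := F) G H) : Type _ := G × H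

variable (M : MatchedPair (E := E) (F := F) G H)

instance : TopologicalSpace M.Bowtie := inferInstanceAs (TopologicalSpace (G × H))

instance : ChartedSpace (ModelProd E F) M.Bowtie :=
  inferInstanceAs (ChartedSpace (ModelProd E F) (G × H))

/-- The element `(g, h)` of `G ⋈ H`. -/
def elt (g : G) (h : H) : M.Bowtie := (g, h)

instance : Group M.Bowtie where
  mul x y := (x.1 * M.ρ x.2 y.1, M.σ x.2 y.1 * y.2)
  one := (1, 1)
  inv x := (M.ρ x.2⁻¹ x.1⁻¹, M.σ x.2⁻¹ x.1⁻¹)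
  mul_assoc x y z := by
    refine Prod.ext ?_ ?_
    · change x.1 * M.ρ x.2 y.1 * M.ρ (M.σ x.2 y.1 * y.2) z.1 = x.1 * M.ρ x.2 (y.1 * M.ρ y.2 z.1)
      rw [M.ρ_mul, M.mul_ρ, mul_assoc]
    · change M.σ (M.σ x.2 y.1 * y.2) z.1 * z.2 = M.σ x.2 (y.1 * M.ρ y.2 z.1) * (M.σ y.2 z.1 * z.2)
      rw [M.mul_σ, M.σ_mul, mul_assoc]
  one_mul x := by
    refine Prod.ext ?_ ?_
    · change 1 * M.ρ 1 x.1 = x.1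
      rw [M.one_ρ, one_mul]
    · change M.σ 1 x.1 * x.2 = x.2
      rw [M.one_σ, one_mul]
  mul_one x := by
    refine Prod.ext ?_ ?_
    · change x.1 * M.ρ x.2 1 = x.1
      rw [M.ρ_one, mul_one]
    · change M.σ x.2 1 * 1 = x.2
      rw [M.σ_one, mul_one]
  inv_mul_cancel x := by
    refine Prod.ext ?_ ?_
    · change M.ρ x.2⁻¹ x.1⁻¹ * M.ρ (M.σ x.2⁻¹ x.1⁻¹) x.1 = 1
      rw [← M.ρ_mul, inv_mul_cancel, M.ρ_one]
    · change M.σ (M.σ x.2⁻¹ x.1⁻¹) x.1 * x.2 = 1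
      rw [← M.σ_mul, inv_mul_cancel, M.σ_one, inv_mul_cancel]

instance : LieGroup (𝓘(ℝ, E).prod 𝓘(ℝ, F)) ∞ M.Bowtie where
  toIsManifold :=
    inferInstanceAs (IsManifold (𝓘(ℝ, E).prod 𝓘(ℝ, F)) ∞ (G × H))
  contMDiff_mul := by
    have a : ContMDiff ((𝓘(ℝ, E).prod 𝓘(ℝ, F)).prod (𝓘(ℝ, E).prod 𝓘(ℝ, F)))
        (𝓘(ℝ, F).prod 𝓘(ℝ, E)) ∞ (fun x : (G × H) × (G × H) => (x.1.2, x.2.1)) :=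
      (contMDiff_snd.comp contMDiff_fst).prodMk (contMDiff_fst.comp contMDiff_snd)
    have b : ContMDiff ((𝓘(ℝ, E).prod 𝓘(ℝ, F)).prod (𝓘(ℝ, E).prod 𝓘(ℝ, F)))
        (𝓘(ℝ, E).prod 𝓘(ℝ, F)) ∞
        (fun x : (G × H) × (G × H) =>
          (x.1.1 * M.ρ x.1.2 x.2.1, M.σ x.1.2 x.2.1 * x.2.2)) :=
      ((contMDiff_fst.comp contMDiff_fst).mul (M.contMDiff_ρ.comp a)).prodMk
        ((M.contMDiff_σ.comp a).mul (contMDiff_snd.comp contMDiff_snd))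
    exact b
  contMDiff_inv := by
    have a : ContMDiff (𝓘(ℝ, E).prod 𝓘(ℝ, F)) (𝓘(ℝ, F).prod 𝓘(ℝ, E)) ∞
        (fun x : G × H => (x.2⁻¹, x.1⁻¹)) :=
      contMDiff_snd.inv.prodMk contMDiff_fst.inv
    have b : ContMDiff (𝓘(ℝ, E).prod 𝓘(ℝ, F)) (𝓘(ℝ, E).prod 𝓘(ℝ, F)) ∞
        (fun x : G × H => (M.ρ x.2⁻¹ x.1⁻¹, M.σ x.2⁻¹ x.1⁻¹)) :=
      (M.contMDiff_ρ.comp a).prodMk (M.contMDiff_σ.comp a)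
    exact b

/-- `T_{e_H} ρ_g : 𝔥 → T_g G`, `η ↦ η ▷ g`. -/
def tangentρ (g : G) : F →L[ℝ] E :=
  (mfderiv 𝓘(ℝ, F) 𝓘(ℝ, E) (fun h : H => M.ρ h g) 1 :
    TangentSpace 𝓘(ℝ, F) (1 : H) →L[ℝ] TangentSpace 𝓘(ℝ, E) (M.ρ 1 g))

/-- The action `h ▷ ξ = T_{e_G} ρ_h ξ` of `H` on `𝔤`. -/
def actρ (h : H) : E →L[ℝ] E :=
  (mfderiv 𝓘(ℝ, E) 𝓘(ℝ, E) (fun g : G => M.ρ h g) 1 :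
    TangentSpace 𝓘(ℝ, E) (1 : G) →L[ℝ] TangentSpace 𝓘(ℝ, E) (M.ρ h 1))

/-- The action `η ◁ g = T_{e_H} σ_g η` of `G` on `𝔥`. -/
def actσ (g : G) : F →L[ℝ] F :=
  (mfderiv 𝓘(ℝ, F) 𝓘(ℝ, F) (fun h : H => M.σ h g) 1 :
    TangentSpace 𝓘(ℝ, F) (1 : H) →L[ℝ] TangentSpace 𝓘(ℝ, F) (M.σ 1 g))

/-- The infinitesimal action `η ▷ ξ ∈ 𝔤`: the derivative at `e_H`, in the direction `η`, of
`h ↦ h ▷ ξ`. -/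
def lieρ (η : F) (ξ : E) : E :=
  (mfderiv 𝓘(ℝ, F) 𝓘(ℝ, E) (fun h : H => M.actρ h ξ) 1 :
    TangentSpace 𝓘(ℝ, F) (1 : H) →L[ℝ] TangentSpace 𝓘(ℝ, E) (M.actρ 1 ξ)) η

/-- The infinitesimal action `η ◁ ξ ∈ 𝔥`: the derivative at `e_G`, in the direction `ξ`, of
`g ↦ η ◁ g`. -/
def lieσ (η : F) (ξ : E) : F :=
  (mfderiv 𝓘(ℝ, E) 𝓘(ℝ, F) (fun g : G => M.actσ g η) 1 :
    TangentSpace 𝓘(ℝ, E) (1 : G) →L[ℝ] TangentSpace 𝓘(ℝ, F) (M.actσ 1 η)) ξ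

/-- The dual action `ξ ▷^* ν` of `𝔤` on `𝔥^*`: `⟨ξ ▷^* ν, η⟩ = ⟨ν, η ◁ ξ⟩`, as a function of
`η`. -/
def starσ (ξ : E) (ν : StrongDual ℝ F) (η : F) : ℝ := ν (M.lieσ η ξ)

/-- The Lie bracket of `𝔤 = T_{e_G} G`. -/
def bracketG (_M : MatchedPair (E := E) (F := F) G H) (ξ₁ ξ₂ : E) : E :=
  Bracket.bracket (L := GroupLieAlgebra 𝓘(ℝ, E) G) (M := GroupLieAlgebra 𝓘(ℝ, E) G) ξ₁ ξ₂

/-- The Lie bracket of `𝔥 = T_{e_H} H`. -/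
def bracketH (_M : MatchedPair (E := E) (F := F) G H) (η₁ η₂ : F) : F :=
  Bracket.bracket (L := GroupLieAlgebra 𝓘(ℝ, F) H) (M := GroupLieAlgebra 𝓘(ℝ, F) H) η₁ η₂

/-- The bracket of the matched pair Lie algebra `𝔤 ⋈ 𝔥`. -/
def bracket (x y : E × F) : E × F :=
  (M.bracketG x.1 y.1 + M.lieρ x.2 y.1 - M.lieρ y.2 x.1,
    M.bracketH x.2 y.2 + M.lieσ x.2 y.1 - M.lieσ y.2 x.1)

/-- The coadjoint action of `𝔤 ⋈ 𝔥` on its dual: `⟨ad^*_x α, y⟩ = -⟨α, [x, y]⟩`. -/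
def coad (x : E × F) (α : StrongDual ℝ (E × F)) : StrongDual ℝ (E × F) :=
  Classical.epsilon fun β : StrongDual ℝ (E × F) => ∀ y, β y = -α (M.bracket x y)

/-- The model with corners of `G ⋈ H`. -/
abbrev model (_M : MatchedPair (E := E) (F := F) G H) :
    ModelWithCorners ℝ (E × F) (ModelProd E F) :=
  𝓘(ℝ, E).prod 𝓘(ℝ, F)

/-- The model with corners of `(𝔤 ⋈ 𝔥)^* × (G ⋈ H)`. -/
abbrev phaseModel (_M : MatchedPair (E := E) (F := F) G H) :
    ModelWithCorners ℝ (StrongDual ℝ (E × F) × (E × F))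
      (ModelProd (StrongDual ℝ (E × F)) (ModelProd E F)) :=
  cotangentModel (𝓘(ℝ, E).prod 𝓘(ℝ, F))

/-- The right-trivialized cotangent bundle `(𝔤 ⋈ 𝔥)^* × (G ⋈ H)`. -/
abbrev Phase : Type _ := TrivCotangent (V := E × F) M.Bowtie

/-- The point `(μ, ν, g, h)`, with `𝔤^* × 𝔥^*` identified with `(𝔤 ⋈ 𝔥)^*` through
`⟨(μ, ν), (ξ, η)⟩ = ⟨μ, ξ⟩ + ⟨ν, η⟩`. -/
def pt (μ : StrongDual ℝ E) (ν : StrongDual ℝ F) (g : G) (h : H) : M.Phase :=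
  (μ.coprod ν, M.elt g h)

/-- The `𝔥^*`-component `ν` of a point `(μ, ν, g, h)`. -/
def νOf (q : M.Phase) : StrongDual ℝ F := q.1.comp (ContinuousLinearMap.inr ℝ E F)

/-- The `G`-component `g` of a point `(μ, ν, g, h)`. -/
def gOf (q : M.Phase) : G := (show G × H from q.2).1

/-- The right invariant vector field on `(𝔤 ⋈ 𝔥)^* ⋊ (G ⋈ H)` generated by `(μ', ν', ξ, η)`:
its value at `(μ, ν, g, h)` is `((μ', ν') + ad^*_{(ξ, η)} (μ, ν), T R_{(g, h)} (ξ, η))`. -/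
def rightInvariant (μ' : StrongDual ℝ E) (ν' : StrongDual ℝ F) (ξ : E) (η : F) (p : M.Phase) :
    TangentSpace M.phaseModel p :=
  ((μ'.coprod ν' + M.coad (ξ, η) p.1, tangentRight M.model p.2 (ξ, η)) :
    StrongDual ℝ (E × F) × (E × F))

section Derivatives

variable (f : M.Phase → ℝ) (μ : StrongDual ℝ E) (ν : StrongDual ℝ F) (g : G) (h : H)

/-- `δf/δμ ∈ 𝔤`. -/
def dμ : E := functionalDeriv (fun μ' => f (M.pt μ' ν g h)) μ

/-- `δf/δν ∈ 𝔥`. -/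
def dν : F := functionalDeriv (fun ν' => f (M.pt μ ν' g h)) ν

/-- `δf/δg ∈ T_g^* G`. -/
def dg : E →L[ℝ] ℝ :=
  (mfderiv 𝓘(ℝ, E) 𝓘(ℝ, ℝ) (fun g' => f (M.pt μ ν g' h)) g : TangentSpace 𝓘(ℝ, E) g →L[ℝ] ℝ)

/-- `δf/δh ∈ T_h^* H`. -/
def dh : F →L[ℝ] ℝ :=
  (mfderiv 𝓘(ℝ, F) 𝓘(ℝ, ℝ) (fun h' => f (M.pt μ ν g h')) h : TangentSpace 𝓘(ℝ, F) h →L[ℝ] ℝ)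

/-- `T^* R_g (δf/δg) ∈ 𝔤^*`. -/
def dgR : StrongDual ℝ E := (M.dg f μ ν g h).comp (tangentRight 𝓘(ℝ, E) g)

/-- `T^* ρ_g (δf/δg) ∈ 𝔥^*`. -/
def dgρ : StrongDual ℝ F := (M.dg f μ ν g h).comp (M.tangentρ g)

/-- `T^* R_h (δf/δh) ∈ 𝔥^*`. -/
def dhR : StrongDual ℝ F := (M.dh f μ ν g h).comp (tangentRight 𝓘(ℝ, F) h)

/-- `g ▷^* T^* R_h (δf/δh) ∈ 𝔥^*`, where `⟨g ▷^* ν, η⟩ = ⟨ν, η ◁ g⟩`. -/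
def dhσ : StrongDual ℝ F := (M.dhR f μ ν g h).comp (M.actσ g)

end Derivatives

end MatchedPair

end

noncomputable section

/-! ### Mixed second derivatives -/

section CrossDeriv

open Filter Topology

/-! Let K be a Lie group modelled on V and ω_k = T_k R_{k⁻¹} its right Maurer-Cartan form. In the
right trivialization the canonical one-form at (μ, k) is μ ∘ ω_k, so computing Ω = -dθ amounts to
computing dω. For the bracket of left-invariant fields the Maurer-Cartan equation reads dω(v, w) =
[ωv, ωw] (`maurerCartan`), whence Ω((β₁, w₁), (β₂, w₂)) = β₂(ωw₁) - β₁(ωw₂) - μ([ωw₁, ωw₂])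
(`canonicalTwoForm_eq`).

If V is reflexive, Ω is strongly nondegenerate: the fibre part of a covector lies in V** and is
therefore a vector ξ, after which the base part determines β. For df the vector ξ is the functional
derivative, and substitution gives a three-term bracket on every right-trivialized cotangent bundle
(`canonicalPoisson_eq`).

The theorem is the case K = G ⋈ H. Two facts about this group are needed: its Lie bracket is the
matched pair bracket (`MatchedPair.bracket_eq_lieBilin`), and T R_{(g,h)}(ξ, η) = (T R_g ξ + T ρ_g
η, T R_h(η ◁ g)) (`MatchedPair.tangentRight_bowtie`). Expanding by linearity produces K, L, M₁, M₂
and N.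

Everything infinitesimal is computed at the units in charts. The Lie bracket is the antisymmetrized
mixed second derivative of the multiplication (`bracket_eq_mulCross_sub`), the infinitesimal actions
are the mixed second derivatives of ρ and σ, and the formula for the bracket of G ⋈ H becomes a
chain rule computation. -/

lemma eventually_prodMk_left {A B : Type*} [TopologicalSpace A] [TopologicalSpace B]
    {p : A × B → Prop} {x : A} {y : B} (h : ∀ᶠ z in 𝓝 (x, y), p z) :
    ∀ᶠ x' in 𝓝 x, p (x', y) :=
  ((Continuous.prodMk_left y).continuousAt (x := x)).eventually h

lemma eventually_prodMk_right {A B : Type*} [TopologicalSpace A] [TopologicalSpace B]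
    {p : A × B → Prop} {x : A} {y : B} (h : ∀ᶠ z in 𝓝 (x, y), p z) :
    ∀ᶠ y' in 𝓝 y, p (x, y') :=
  ((Continuous.prodMk_right x).continuousAt (x := y)).eventually h

variable {A B C : Type*} [NormedAddCommGroup A] [NormedSpace ℝ A] [NormedAddCommGroup B]
  [NormedSpace ℝ B] [NormedAddCommGroup C] [NormedSpace ℝ C]

/-- The mixed second derivative `D₁ D₂ f` at `p` of a function `f` of two variables. -/
def crossDeriv (f : A × B → C) (p : A × B) : A →L[ℝ] B →L[ℝ] C :=
  ((ContinuousLinearMap.compL ℝ B (A × B) C).flip (ContinuousLinearMap.inr ℝ A B)).comp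
    ((fderiv ℝ (fderiv ℝ f) p).comp (ContinuousLinearMap.inl ℝ A B))

lemma hasFDerivAt_snd_slot {f : A × B → C} {x : A} {y : B} (h : DifferentiableAt ℝ f (x, y)) :
    HasFDerivAt (fun y' => f (x, y')) ((fderiv ℝ f (x, y)).comp (ContinuousLinearMap.inr ℝ A B))
      y :=
  HasFDerivAt.comp y h.hasFDerivAt (hasFDerivAt_prodMk_right x y)

lemma hasFDerivAt_fst_slot {f : A × B → C} {x : A} {y : B} (h : DifferentiableAt ℝ f (x, y)) :
    HasFDerivAt (fun x' => f (x', y)) ((fderiv ℝ f (x, y)).comp (ContinuousLinearMap.inl ℝ A B))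
      x :=
  HasFDerivAt.comp x h.hasFDerivAt (hasFDerivAt_prodMk_left x y)

lemma ContDiffAt.differentiableAt_fderiv {f : A → C} {x : A} (h : ContDiffAt ℝ 2 f x) :
    DifferentiableAt ℝ (fderiv ℝ f) x :=
  (h.fderiv_right (m := 1) (by norm_num)).differentiableAt (by norm_num)

lemma ContDiffAt.eventually_differentiableAt {f : A → C} {x : A} (h : ContDiffAt ℝ 2 f x) :
    ∀ᶠ y in 𝓝 x, DifferentiableAt ℝ f y := by
  filter_upwards [h.eventually (by simp)] with y hy
  exact hy.differentiableAt (by norm_num)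

/-- `D₁ D₂ f` as an iterated partial derivative. -/
lemma hasFDerivAt_fderiv_snd_slot {f : A × B → C} {a : A} {b : B} (h : ContDiffAt ℝ 2 f (a, b)) :
    HasFDerivAt (fun x => fderiv ℝ (fun y => f (x, y)) b) (crossDeriv f (a, b)) a := by
  have h1 : HasFDerivAt (fun x => (fderiv ℝ f (x, b)).comp (ContinuousLinearMap.inr ℝ A B))
      (crossDeriv f (a, b)) a :=
    (((ContinuousLinearMap.compL ℝ B (A × B) C).flip
      (ContinuousLinearMap.inr ℝ A B)).hasFDerivAt).comp a
      (HasFDerivAt.comp a h.differentiableAt_fderiv.hasFDerivAt (hasFDerivAt_prodMk_left a b))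
  refine h1.congr_of_eventuallyEq ?_
  filter_upwards [eventually_prodMk_left h.eventually_differentiableAt] with x hx
  exact (hasFDerivAt_snd_slot hx).fderiv

/-- `D₂ D₁ f` as an iterated partial derivative. -/
lemma hasFDerivAt_fderiv_fst_slot {f : A × B → C} {a : A} {b : B} (h : ContDiffAt ℝ 2 f (a, b)) :
    HasFDerivAt (fun y => fderiv ℝ (fun x => f (x, y)) a) (crossDeriv f (a, b)).flip b := by
  have h1 : HasFDerivAt (fun y => (fderiv ℝ f (a, y)).comp (ContinuousLinearMap.inl ℝ A B))
      (((ContinuousLinearMap.compL ℝ A (A × B) C).flip (ContinuousLinearMap.inl ℝ A B)).comp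
        ((fderiv ℝ (fderiv ℝ f) (a, b)).comp (ContinuousLinearMap.inr ℝ A B))) b :=
    (((ContinuousLinearMap.compL ℝ A (A × B) C).flip
      (ContinuousLinearMap.inl ℝ A B)).hasFDerivAt).comp b
      (HasFDerivAt.comp b h.differentiableAt_fderiv.hasFDerivAt (hasFDerivAt_prodMk_right a b))
  -- Schwarz's theorem: D₂ D₁ f is the transpose of D₁ D₂ f.
  have h2 : (((ContinuousLinearMap.compL ℝ A (A × B) C).flip (ContinuousLinearMap.inl ℝ A B)).comp
        ((fderiv ℝ (fderiv ℝ f) (a, b)).comp (ContinuousLinearMap.inr ℝ A B))) =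
      (crossDeriv f (a, b)).flip := by
    ext w v
    exact (h.isSymmSndFDerivAt (by simp)) (0, w) (v, 0)
  rw [h2] at h1
  refine h1.congr_of_eventuallyEq ?_
  filter_upwards [eventually_prodMk_right h.eventually_differentiableAt] with x hx
  exact (hasFDerivAt_fst_slot hx).fderiv

lemma crossDeriv_congr {f g : A × B → C} {p : A × B} (h : f =ᶠ[𝓝 p] g) :
    crossDeriv f p = crossDeriv g p := by
  have : fderiv ℝ (fderiv ℝ f) p = fderiv ℝ (fderiv ℝ g) p := h.fderiv.fderiv_eq
  simp only [crossDeriv, this]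

/-- The chain rule for mixed derivatives under a change of each variable separately. -/
lemma crossDeriv_comp_prodMap {A' B' : Type*} [NormedAddCommGroup A'] [NormedSpace ℝ A']
    [NormedAddCommGroup B'] [NormedSpace ℝ B'] {f : A × B → C} {u : A' → A} {u' : B' → B}
    {a : A'} {b : B'} (hf : ContDiffAt ℝ 2 f (u a, u' b)) (hu : ContDiffAt ℝ 2 u a)
    (hu' : ContDiffAt ℝ 2 u' b) (v : A') (w : B') :
    crossDeriv (fun z : A' × B' => f (u z.1, u' z.2)) (a, b) v w =
      crossDeriv f (u a, u' b) (fderiv ℝ u a v) (fderiv ℝ u' b w) := by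
  have hF : ContDiffAt ℝ 2 (fun z : A' × B' => f (u z.1, u' z.2)) (a, b) := by
    refine ContDiffAt.comp (a, b) (g := f) (f := fun z : A' × B' => (u z.1, u' z.2)) hf ?_
    exact (hu.comp (a, b) contDiffAt_fst).prodMk (hu'.comp (a, b) contDiffAt_snd)
  have d := (hasFDerivAt_fderiv_snd_slot hF)
  -- The factor `fderiv ℝ u' b` does not depend on x, so differentiating in x produces no second
  -- derivative of `u` or `u'`.
  have hd : (fun x => fderiv ℝ (fun y => f (u x, u' y)) b) =ᶠ[𝓝 a]
      fun x => (fderiv ℝ (fun y => f (u x, y)) (u' b)).comp (fderiv ℝ u' b) := by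
    have := hu.continuousAt.eventually (eventually_prodMk_left hf.eventually_differentiableAt)
    filter_upwards [this] with x hx
    exact ((hasFDerivAt_snd_slot hx).differentiableAt.hasFDerivAt.comp b
      (hu'.differentiableAt (by norm_num)).hasFDerivAt).fderiv
  have d2 := (d.congr_of_eventuallyEq hd.symm)
  have d3 : HasFDerivAt (fun x => (fderiv ℝ (fun y => f (u x, y)) (u' b)).comp (fderiv ℝ u' b)) _ a
      := (((ContinuousLinearMap.compL ℝ B' B C).flip (fderiv ℝ u' b)).hasFDerivAt).comp a
        ((hasFDerivAt_fderiv_snd_slot hf).comp a (hu.differentiableAt (by norm_num)).hasFDerivAt)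
  have := d2.unique d3
  rw [this]
  rfl

end CrossDeriv

/-! ### Functions of two variables read in charts -/

section InCharts

open Filter Topology

variable {VA : Type*} [NormedAddCommGroup VA] [NormedSpace ℝ VA] {SA : Type*} [TopologicalSpace SA]
  {IA : ModelWithCorners ℝ VA SA} {A : Type*} [TopologicalSpace A] [ChartedSpace SA A]
  {VB : Type*} [NormedAddCommGroup VB] [NormedSpace ℝ VB] {SB : Type*} [TopologicalSpace SB]
  {IB : ModelWithCorners ℝ VB SB} {B : Type*} [TopologicalSpace B] [ChartedSpace SB B]
  {VC : Type*} [NormedAddCommGroup VC] [NormedSpace ℝ VC] {SC : Type*} [TopologicalSpace SC]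
  {IC : ModelWithCorners ℝ VC SC} {C : Type*} [TopologicalSpace C] [ChartedSpace SC C]

variable (IA IB IC) in
/-- The function `f` of two variables, read in the charts at `a`, `b` and `c`. -/
def inCharts (f : A → B → C) (a : A) (b : B) (c : C) (z : VA × VB) : VC :=
  extChartAt IC c (f ((extChartAt IA a).symm z.1) ((extChartAt IB b).symm z.2))

lemma contMDiffAt_extChartAt_symm' [IA.Boundaryless] {n : ℕ∞ω} [IsManifold IA n A]
    (a : A) {y : VA} (hy : y ∈ (extChartAt IA a).target) :
    ContMDiffAt 𝓘(ℝ, VA) IA n (extChartAt IA a).symm y :=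
  (contMDiffOn_extChartAt_symm a).contMDiffAt (extChartAt_target_mem_nhds' hy)

lemma contDiffAt_inChart [IA.Boundaryless] {n : ℕ∞ω} [IsManifold IA n A] [IsManifold IC n C]
    {g : A → C} {a : A} {c : C} {y : VA} (hy : y ∈ (extChartAt IA a).target)
    (hc : g ((extChartAt IA a).symm y) ∈ (chartAt SC c).source)
    (hg : ContMDiffAt IA IC n g ((extChartAt IA a).symm y)) :
    ContDiffAt ℝ n (fun x => extChartAt IC c (g ((extChartAt IA a).symm x))) y := by
  rw [← contMDiffAt_iff_contDiffAt]
  exact ((contMDiffAt_extChartAt' hc).comp _ hg).comp y (contMDiffAt_extChartAt_symm' a hy)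

lemma contDiffAt_inCharts [IA.Boundaryless] [IB.Boundaryless] {n : ℕ∞ω} [IsManifold IA n A]
    [IsManifold IB n B] [IsManifold IC n C] {f : A → B → C} {a : A} {b : B} {c : C}
    (hf : ContMDiffAt (IA.prod IB) IC n (fun z : A × B => f z.1 z.2) (a, b))
    (hc : f a b ∈ (chartAt SC c).source) :
    ContDiffAt ℝ n (inCharts IA IB IC f a b c) (extChartAt IA a a, extChartAt IB b b) := by
  have h1 : ContMDiffAt 𝓘(ℝ, VA × VB) IA n (fun z : VA × VB => (extChartAt IA a).symm z.1)
      (extChartAt IA a a, extChartAt IB b b) :=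
    ContMDiffAt.comp (extChartAt IA a a, extChartAt IB b b) (g := (extChartAt IA a).symm)
      (contMDiffAt_extChartAt_symm' a (mem_extChartAt_target a)) contDiffAt_fst.contMDiffAt
  have h2 : ContMDiffAt 𝓘(ℝ, VA × VB) IB n (fun z : VA × VB => (extChartAt IB b).symm z.2)
      (extChartAt IA a a, extChartAt IB b b) :=
    ContMDiffAt.comp (extChartAt IA a a, extChartAt IB b b) (g := (extChartAt IB b).symm)
      (contMDiffAt_extChartAt_symm' b (mem_extChartAt_target b)) contDiffAt_snd.contMDiffAt
  rw [← contMDiffAt_iff_contDiffAt]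
  refine ContMDiffAt.comp _ (g := extChartAt IC c) (I' := IC)
    (contMDiffAt_extChartAt' (by simpa using hc)) ?_
  refine ContMDiffAt.comp _ (g := fun z : A × B => f z.1 z.2) (I' := IA.prod IB) ?_
    (h1.prodMk h2)
  simpa only [extChartAt_to_inv] using hf

/-- The tangent map of `g` at `b`, read in the charts at `b` and `g b`. -/
lemma mfderiv_eq_fderiv_inChart [IB.Boundaryless] {g : B → C} {b : B} {c : C} (h : g b = c)
    (hg : MDifferentiableAt IB IC g b) :
    (mfderiv IB IC g b : VB →L[ℝ] VC) =
      fderiv ℝ (fun y => extChartAt IC c (g ((extChartAt IB b).symm y))) (extChartAt IB b b) := by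
  subst h
  refine Eq.trans (b := fderivWithin ℝ (writtenInExtChartAt IB IC b g) (Set.range IB)
    (extChartAt IB b b)) hg.mfderiv ?_
  rw [IB.range_eq_univ, fderivWithin_univ]
  rfl

/-- The tangent map of `g` at `b`, followed by the tangent map of the chart at `c`. -/
lemma mfderiv_extChartAt_mfderiv_apply [IB.Boundaryless] [IsManifold IC 1 C]
    {g : B → C} {b : B} {c : C}
    (h : g b ∈ (chartAt SC c).source) (hg : MDifferentiableAt IB IC g b) (v : VB) :
    (mfderiv IC 𝓘(ℝ, VC) (extChartAt IC c) (g b) (mfderiv IB IC g b v) : VC) =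
      fderiv ℝ (fun y => extChartAt IC c (g ((extChartAt IB b).symm y))) (extChartAt IB b b) v := by
  have h0 := mdifferentiableAt_extChartAt (I := IC) h
  have h1 := mfderiv_comp_apply b h0 hg v
  exact h1.symm.trans (congrArg (fun L : VB →L[ℝ] VC => L v)
    (mfderiv_eq_fderiv_inChart (c := extChartAt IC c (g b)) rfl (h0.comp b hg)))

end InCharts

/-! ### The Lie bracket in charts -/

section LieBracketInCharts

open Filter Topology VectorField

variable {V : Type*} [NormedAddCommGroup V] [NormedSpace ℝ V] {S : Type*} [TopologicalSpace S]
  (I : ModelWithCorners ℝ V S) [I.Boundaryless] (K : Type*) [TopologicalSpace K]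
  [ChartedSpace S K] [Group K]

/-- The multiplication of `K` in the chart at `1`. -/
def mulInChart : V × V → V := inCharts I I I (fun x y : K => x * y) 1 1 1

/-- The mixed second derivative at the unit of the multiplication read in the chart at `1`. -/
def mulCross : V →L[ℝ] V →L[ℝ] V :=
  crossDeriv (mulInChart I K) (extChartAt I (1 : K) 1, extChartAt I (1 : K) 1)

/-- The Lie bracket of `K` as a continuous bilinear map. -/
def lieBilin : V →L[ℝ] V →L[ℝ] V := mulCross I K - (mulCross I K).flip

variable [LieGroup I ∞ K]

lemma contDiffAt_mulInChart :
    ContDiffAt ℝ 2 (mulInChart I K) (extChartAt I (1 : K) 1, extChartAt I (1 : K) 1) :=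
  (contDiffAt_inCharts (n := ∞) (contMDiff_mul I ∞).contMDiffAt (by simp)).of_le
    (WithTop.coe_le_coe.2 le_top)

omit [LieGroup I ∞ K] in
lemma mulInChart_unit_left : ∀ᶠ y in 𝓝 (extChartAt I (1 : K) 1),
    mulInChart I K (extChartAt I (1 : K) 1, y) = y := by
  filter_upwards [extChartAt_target_mem_nhds (I := I) (1 : K)] with y hy
  simp only [mulInChart, inCharts, extChartAt_to_inv, one_mul, (extChartAt I (1 : K)).right_inv hy]

omit [LieGroup I ∞ K] in
lemma mulInChart_unit_right : ∀ᶠ y in 𝓝 (extChartAt I (1 : K) 1),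
    mulInChart I K (y, extChartAt I (1 : K) 1) = y := by
  filter_upwards [extChartAt_target_mem_nhds (I := I) (1 : K)] with y hy
  simp only [mulInChart, inCharts, extChartAt_to_inv, mul_one, (extChartAt I (1 : K)).right_inv hy]

variable {K}

/-- A left invariant vector field, read in the chart at `1`. -/
lemma mfderiv_extChartAt_mulInvariantVectorField (v : V) {g : K}
    (hg : g ∈ (chartAt S (1 : K)).source) :
    (mfderiv I 𝓘(ℝ, V) (extChartAt I (1 : K)) g
        (mulInvariantVectorField (I := I) (v : GroupLieAlgebra I K) g) : V) =
      fderiv ℝ (fun y => mulInChart I K (extChartAt I (1 : K) g, y)) (extChartAt I (1 : K) 1) v := by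
  have : IsManifold I 1 K := IsManifold.of_le (n := ∞) (WithTop.coe_le_coe.2 le_top)
  have h2 : (fun y => mulInChart I K (extChartAt I (1 : K) g, y)) =
      (fun y => extChartAt I (1 : K) (g * (extChartAt I (1 : K)).symm y)) := by
    ext y
    simp only [mulInChart, inCharts, (extChartAt I (1 : K)).left_inv
      (by rwa [extChartAt_source] : g ∈ (extChartAt I (1 : K)).source)]
  rw [h2, ← mfderiv_extChartAt_mfderiv_apply (IB := I) (IC := I) (g := fun x : K => g * x) (b := 1)
    (c := 1) (by simpa using hg)
    ((contMDiff_mul_left (I := I) (n := ∞)).contMDiffAt.mdifferentiableAt (by simp))]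
  -- The tangent map of left translation lands over `g * 1`; this moves the base point to `g`.
  have e : ∀ g' : K, g' = g → ∀ t : V, (mfderiv I 𝓘(ℝ, V) (extChartAt I (1 : K)) g t : V) =
      mfderiv I 𝓘(ℝ, V) (extChartAt I (1 : K)) g' t := by
    rintro _ rfl _; rfl
  exact e _ (mul_one g) _

/-- With m the multiplication in the chart at 1 and c the coordinate of 1, the left-invariant field
of u reads x ↦ D₂m(x, c)u. It takes the value u at c and has derivative t ↦ D₁D₂m(t, u) there, so
the bracket of vector fields is the antisymmetrization of D₁D₂m. -/
theorem bracket_eq_mulCross_sub (v w : V) :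
    (Bracket.bracket (L := GroupLieAlgebra I K) (M := GroupLieAlgebra I K) v w : V) =
      mulCross I K v w - mulCross I K w v := by
  have : IsManifold I 1 K := IsManifold.of_le (n := ∞) (WithTop.coe_le_coe.2 le_top)
  let c := extChartAt I (1 : K) 1
  let X : V → V → V := fun u => mpullbackWithin 𝓘(ℝ, V) I (extChartAt I (1 : K)).symm
      (mulInvariantVectorField (I := I) (u : GroupLieAlgebra I K)) (Set.range I)
  have key : ∀ u : V, X u =ᶠ[𝓝 c] fun x => fderiv ℝ (fun y => mulInChart I K (x, y)) c u := by
    intro u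
    filter_upwards [extChartAt_target_mem_nhds (I := I) (1 : K)] with x hx
    have hs : (extChartAt I (1 : K)).symm x ∈ (chartAt S (1 : K)).source := by
      rw [← extChartAt_source (I := I)]; exact (extChartAt I (1 : K)).map_target hx
    have h1 := mfderiv_extChartAt_mulInvariantVectorField I u hs
    rw [(extChartAt I (1 : K)).right_inv hx] at h1
    -- Pulling back by the inverse chart applies the inverse of its tangent map, which is the
    -- tangent map of the chart.
    have h3 : (mfderivWithin 𝓘(ℝ, V) I (extChartAt I (1 : K)).symm (Set.range I) x).inverse =
        mfderiv I 𝓘(ℝ, V) (extChartAt I (1 : K)) ((extChartAt I (1 : K)).symm x) :=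
      ContinuousLinearMap.inverse_eq (mfderivWithin_extChartAt_symm_comp_mfderiv_extChartAt hx)
        (mfderiv_extChartAt_comp_mfderivWithin_extChartAt_symm hx)
    refine Eq.trans ?_ h1
    exact congrArg (fun L : V →L[ℝ] V => L (mulInvariantVectorField (I := I)
      (u : GroupLieAlgebra I K) ((extChartAt I (1 : K)).symm x))) h3
  have hD : ∀ u : V, HasFDerivAt (X u) ((mulCross I K).flip u) c := fun u =>
    ((hasFDerivAt_fderiv_snd_slot (contDiffAt_mulInChart I K)).clm_apply
      (hasFDerivAt_const u c)).congr_of_eventuallyEq (key u) |>.congr_fderiv (by ext; simp [mulCross])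
  have hX : ∀ u : V, X u c = u := by
    intro u
    refine (key u).self_of_nhds.trans ?_
    change fderiv ℝ (fun y => mulInChart I K (c, y)) c u = u
    have : (fun y => mulInChart I K (c, y)) =ᶠ[𝓝 c] id := mulInChart_unit_left I K
    rw [this.fderiv_eq, fderiv_id]; rfl
  -- Tangent vectors at 1 are represented in the preferred chart at 1, so the tangent map of that
  -- chart is the identity there.
  have h4 : ∀ u : V, ((mfderiv I 𝓘(ℝ, V) (extChartAt I (1 : K)) 1).inverse u : V) = u := by
    intro u
    have a : (mfderiv I 𝓘(ℝ, V) (extChartAt I (1 : K)) 1 : V →L[ℝ] V) =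
      ContinuousLinearMap.id ℝ V := mfderiv_extChartAt_self
    exact (congrArg (fun L : V →L[ℝ] V => L.inverse u) a).trans
      (by rw [ContinuousLinearMap.inverse_id]; rfl)
  have h5 : (Bracket.bracket (L := GroupLieAlgebra I K) (M := GroupLieAlgebra I K) v w : V) =
      lieBracketWithin ℝ (X v) (X w) ((extChartAt I (1 : K)).symm ⁻¹' Set.univ ∩ Set.range I) c :=
    h4 _
  -- `lieBracket` of X and Y is DY(X) - DX(Y), which fixes the order of the two mixed derivatives.
  rw [h5, I.range_eq_univ, Set.preimage_univ, Set.univ_inter, lieBracketWithin_univ,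
    lieBracket, (hD v).fderiv, (hD w).fderiv, hX, hX]
  rfl

lemma bracket_eq_lieBilin (v w : V) :
    (Bracket.bracket (L := GroupLieAlgebra I K) (M := GroupLieAlgebra I K) v w : V) =
      lieBilin I K v w :=
  bracket_eq_mulCross_sub I v w

end LieBracketInCharts

/-! ### The right Maurer-Cartan form -/

section MaurerCartan

open Filter Topology

variable {V : Type*} [NormedAddCommGroup V] [NormedSpace ℝ V] {S : Type*} [TopologicalSpace S]
  (I : ModelWithCorners ℝ V S) [I.Boundaryless] {K : Type*} [TopologicalSpace K]
  [ChartedSpace S K] [Group K]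

/-- The value at `k` of the right Maurer-Cartan form, `T_k R_{k⁻¹} : T_k K → 𝔨`. -/
def rightForm (k : K) : V →L[ℝ] V :=
  (mfderiv I I (fun x : K => x * k⁻¹) k : TangentSpace I k →L[ℝ] TangentSpace I (k * k⁻¹))

/-- The map `(x, y) ↦ x y⁻¹`, read in the charts at `k` and `1`. -/
def divInChart (k : K) : V × V → V := inCharts I I I (fun x y : K => x * y⁻¹) k k 1

/-- The right Maurer-Cartan form, read in the chart at `k`. -/
def rightFormInChart (k : K) (x : V) : V →L[ℝ] V :=
  (fderiv ℝ (divInChart I k) (x, x)).comp (ContinuousLinearMap.inl ℝ V V)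

variable [LieGroup I ∞ K]

omit [I.Boundaryless] in
lemma isManifold_one_of_lieGroup : IsManifold I 1 K :=
  IsManifold.of_le (n := ∞) (WithTop.coe_le_coe.2 le_top)

lemma contDiffAt_divInChart (k : K) :
    ContDiffAt ℝ 2 (divInChart I k) (extChartAt I k k, extChartAt I k k) :=
  (contDiffAt_inCharts (n := ∞) (contMDiff_fst.mul contMDiff_snd.inv).contMDiffAt (by simp)).of_le
    (WithTop.coe_le_coe.2 le_top)

omit [I.Boundaryless] in
lemma mdiffAt_mul_right (k x : K) : MDifferentiableAt I I (fun x : K => x * k) x :=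
  (contMDiff_mul_right (I := I) (n := ∞)).contMDiffAt.mdifferentiableAt (by simp)

lemma tangentRight_eq_fderiv (k : K) : tangentRight I k =
    fderiv ℝ (fun y => extChartAt I k ((extChartAt I (1 : K)).symm y * k))
      (extChartAt I (1 : K) 1) :=
  mfderiv_eq_fderiv_inChart (IB := I) (IC := I) (one_mul k) (mdiffAt_mul_right I k 1)

lemma rightForm_eq_fderiv (k : K) : rightForm I k =
    fderiv ℝ (fun y => extChartAt I (1 : K) ((extChartAt I k).symm y * k⁻¹))
      (extChartAt I k k) :=
  mfderiv_eq_fderiv_inChart (IB := I) (IC := I) (mul_inv_cancel k)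
    (mdiffAt_mul_right I k⁻¹ k)

lemma rightFormInChart_self (k : K) : rightFormInChart I k (extChartAt I k k) = rightForm I k := by
  rw [rightForm_eq_fderiv, rightFormInChart, ← (hasFDerivAt_fst_slot
    ((contDiffAt_divInChart I k).differentiableAt (by norm_num))).fderiv]
  simp only [divInChart, inCharts, extChartAt_to_inv]

lemma contDiffAt_mul_right_inChart (a b k : K) (h : a * k = b) :
    ContDiffAt ℝ 2 (fun y => extChartAt I b ((extChartAt I a).symm y * k)) (extChartAt I a a) :=
  (contDiffAt_inChart (n := ∞) (g := fun x : K => x * k) (mem_extChartAt_target a)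
    (by subst h; simp) contMDiff_mul_right.contMDiffAt).of_le (WithTop.coe_le_coe.2 le_top)

/-- This is R_{k⁻¹} ∘ R_k = id differentiated in charts. The endpoints a and b are kept general so
that the case 1 → k and the case k → 1 with k⁻¹ yield both compositions of `rightForm` and
`tangentRight`. -/
lemma fderiv_mul_right_inChart_comp (a b k : K) (h : a * k = b) :
    (fderiv ℝ (fun y => extChartAt I a ((extChartAt I b).symm y * k⁻¹)) (extChartAt I b b)).comp
      (fderiv ℝ (fun y => extChartAt I b ((extChartAt I a).symm y * k)) (extChartAt I a a)) =
    ContinuousLinearMap.id ℝ V := by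
  have h' : b * k⁻¹ = a := by rw [← h, mul_inv_cancel_right]
  have h1 := (contDiffAt_mul_right_inChart I a b k h).differentiableAt (by norm_num)
  have h2 := (contDiffAt_mul_right_inChart I b a k⁻¹ h').differentiableAt (by norm_num)
  have e : extChartAt I b ((extChartAt I a).symm (extChartAt I a a) * k) =
    extChartAt I b b := by rw [extChartAt_to_inv, h]
  rw [← e] at h2 ⊢
  refine (HasFDerivAt.comp (extChartAt I a a) h2.hasFDerivAt h1.hasFDerivAt).fderiv.symm.trans ?_
  refine Eq.trans (Filter.EventuallyEq.fderiv_eq ?_) fderiv_id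
  have hc : ContinuousAt (fun y => (extChartAt I a).symm y * k) (extChartAt I a a) :=
    ((mdiffAt_mul_right I k _).continuousAt).comp (continuousAt_extChartAt_symm a)
  have hs := hc.eventually (by
    simp only [extChartAt_to_inv, h]
    exact extChartAt_source_mem_nhds (I := I) b)
  filter_upwards [hs, extChartAt_target_mem_nhds (I := I) a] with y hy hy1
  simp only [Function.comp_def, (extChartAt I b).left_inv hy, mul_inv_cancel_right,
    (extChartAt I a).right_inv hy1, id]

lemma rightForm_comp_tangentRight (k : K) :
    (rightForm I k).comp (tangentRight I k) = ContinuousLinearMap.id ℝ V := by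
  rw [tangentRight_eq_fderiv, rightForm_eq_fderiv]
  exact fderiv_mul_right_inChart_comp I 1 k k (one_mul k)

lemma tangentRight_comp_rightForm (k : K) :
    (tangentRight I k).comp (rightForm I k) = ContinuousLinearMap.id ℝ V := by
  rw [tangentRight_eq_fderiv, rightForm_eq_fderiv]
  simpa only [inv_inv] using fderiv_mul_right_inChart_comp I k 1 k⁻¹ (mul_inv_cancel k)

lemma rightForm_tangentRight (k : K) (v : V) : rightForm I k (tangentRight I k v) = v :=
  congrArg (fun L : V →L[ℝ] V => L v) (rightForm_comp_tangentRight I k)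

lemma tangentRight_rightForm (k : K) (v : V) : tangentRight I k (rightForm I k v) = v :=
  congrArg (fun L : V →L[ℝ] V => L v) (tangentRight_comp_rightForm I k)

/-- The mixed derivative of `(x, y) ↦ x y⁻¹` in charts. -/
lemma crossDeriv_divInChart (k : K) (v w : V) :
    crossDeriv (divInChart I k) (extChartAt I k k, extChartAt I k k) v w =
      -mulCross I K (rightForm I k v) (rightForm I k w) := by
  let x₀ := extChartAt I k k
  let c := extChartAt I (1 : K) 1
  let u : V → V := fun y => extChartAt I (1 : K) ((extChartAt I k).symm y * k⁻¹)
  let u' : V → V := fun y => extChartAt I (1 : K) (k * ((extChartAt I k).symm y)⁻¹)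
  have hu : ContDiffAt ℝ 2 u x₀ := contDiffAt_mul_right_inChart I k 1 k⁻¹ (mul_inv_cancel k)
  have hu' : ContDiffAt ℝ 2 u' x₀ :=
    (contDiffAt_inChart (n := ∞) (g := fun x : K => k * x⁻¹) (mem_extChartAt_target k)
      (by simp) (contMDiff_const.mul contMDiff_id.inv).contMDiffAt).of_le
      (WithTop.coe_le_coe.2 le_top)
  have hux : u x₀ = c := by simp only [u, x₀, c, extChartAt_to_inv, mul_inv_cancel]
  have hux' : u' x₀ = c := by simp only [u', x₀, c, extChartAt_to_inv, mul_inv_cancel]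
  have hm := contDiffAt_mulInChart I K
  -- Write x y⁻¹ = (x k⁻¹)(k y⁻¹). Both factors stay near 1 for x, y near k, so the product is
  -- `mulInChart` with each variable changed separately.
  have hF : divInChart I k =ᶠ[𝓝 (x₀, x₀)] fun z => mulInChart I K (u z.1, u' z.2) := by
    have hc : ContinuousAt (fun y => (extChartAt I k).symm y * k⁻¹) x₀ :=
      ((mdiffAt_mul_right I k⁻¹ _).continuousAt).comp (continuousAt_extChartAt_symm k)
    have hc' : ContinuousAt (fun y => k * ((extChartAt I k).symm y)⁻¹) x₀ :=
      ContinuousAt.comp (g := fun x : K => k * x⁻¹)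
        (contMDiff_const.mul (contMDiff_id (I := I) (n := ∞)).inv).continuous.continuousAt
        (continuousAt_extChartAt_symm k)
    have hs := hc.eventually (by
      simp only [x₀, extChartAt_to_inv, mul_inv_cancel]
      exact extChartAt_source_mem_nhds (I := I) (1 : K))
    have hs' := hc'.eventually (by
      simp only [x₀, extChartAt_to_inv, mul_inv_cancel]
      exact extChartAt_source_mem_nhds (I := I) (1 : K))
    rw [nhds_prod_eq]
    filter_upwards [hs.prod_mk hs'] with z hz
    simp only [divInChart, mulInChart, inCharts, u, u', (extChartAt I (1 : K)).left_inv hz.1,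
      (extChartAt I (1 : K)).left_inv hz.2]
    group
  have hω : fderiv ℝ u x₀ = rightForm I k := (rightForm_eq_fderiv I k).symm
  -- Differentiate (y k⁻¹)(k y⁻¹) = 1 at y = k. At the unit the derivative of the multiplication is
  -- addition, so the derivatives of the two factors are opposite.
  have hω' : fderiv ℝ u' x₀ = -rightForm I k := by
    have h1 : (fun y => mulInChart I K (u y, u' y)) =ᶠ[𝓝 x₀] fun _ => c := by
      have := (continuous_id.prodMk continuous_id : Continuous fun y : V => (y, y)).continuousAt
        (x := x₀) |>.eventually hF
      filter_upwards [this] with y hy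
      exact hy.symm.trans (by simp [divInChart, inCharts, c])
    have h2 : HasFDerivAt (fun y => mulInChart I K (u y, u' y))
        ((fderiv ℝ (mulInChart I K) (c, c)).comp ((fderiv ℝ u x₀).prod (fderiv ℝ u' x₀))) x₀ := by
      refine HasFDerivAt.comp x₀ (g := mulInChart I K) ?_
        ((hu.differentiableAt (by norm_num)).hasFDerivAt.prodMk
          (hu'.differentiableAt (by norm_num)).hasFDerivAt)
      rw [hux, hux']
      exact (hm.differentiableAt (by norm_num)).hasFDerivAt
    have h3 := h2.unique ((hasFDerivAt_const c x₀).congr_of_eventuallyEq h1)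
    have hl := (hasFDerivAt_fst_slot (hm.differentiableAt (by norm_num))).unique
      ((hasFDerivAt_id c).congr_of_eventuallyEq (mulInChart_unit_right I K))
    have hr := (hasFDerivAt_snd_slot (hm.differentiableAt (by norm_num))).unique
      ((hasFDerivAt_id c).congr_of_eventuallyEq (mulInChart_unit_left I K))
    ext t
    have h4 := congrArg (fun L : V →L[ℝ] V => L t) h3
    have h5 := congrArg (fun L : V →L[ℝ] V => L (fderiv ℝ u x₀ t)) hl
    have h6 := congrArg (fun L : V →L[ℝ] V => L (fderiv ℝ u' x₀ t)) hr
    simp only [ContinuousLinearMap.comp_apply, ContinuousLinearMap.inl_apply,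
      ContinuousLinearMap.inr_apply, ContinuousLinearMap.prod_apply, ContinuousLinearMap.id_apply,
      zero_apply] at h4 h5 h6
    have h7 : (fderiv ℝ u x₀ t, fderiv ℝ u' x₀ t) =
      (fderiv ℝ u x₀ t, 0) + (0, fderiv ℝ u' x₀ t) := by simp
    rw [h7, map_add, h5, h6] at h4
    rw [neg_apply, ← hω]
    exact eq_neg_of_add_eq_zero_right h4
  have hcomp := crossDeriv_comp_prodMap (f := mulInChart I K) (u := u) (u' := u') (a := x₀)
    (b := x₀) (by rw [hux, hux']; exact hm) hu hu' v w
  rw [crossDeriv_congr hF, hcomp, hω, hω', hux, hux']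
  simp [mulCross, c]

/-- The right Maurer-Cartan form in the chart at `k` is differentiable, and its exterior derivative
is given by the Maurer-Cartan equation. -/
theorem maurerCartan (k : K) : ∃ L : V →L[ℝ] V →L[ℝ] V,
    HasFDerivAt (rightFormInChart I k) L (extChartAt I k k) ∧
    ∀ v w, L v w - L w v =
      lieBilin I K (rightForm I k v) (rightForm I k w) := by
  let x₀ := extChartAt I k k
  have hF := contDiffAt_divInChart I k
  let D := fderiv ℝ (fderiv ℝ (divInChart I k)) (x₀, x₀)
  have h1 : HasFDerivAt (fun x : V => (x, x))
      ((ContinuousLinearMap.id ℝ V).prod (ContinuousLinearMap.id ℝ V)) x₀ :=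
    (hasFDerivAt_id x₀).prodMk (hasFDerivAt_id x₀)
  have h2 := (((ContinuousLinearMap.compL ℝ V (V × V) V).flip
      (ContinuousLinearMap.inl ℝ V V)).hasFDerivAt).comp x₀
      (HasFDerivAt.comp x₀ (f := fun x : V => (x, x)) hF.differentiableAt_fderiv.hasFDerivAt h1)
  refine ⟨_, h2, fun v w => ?_⟩
  have hsym : ∀ a b, D a b = D b a := hF.isSymmSndFDerivAt (by simp)
  change D (v, v) (w, 0) - D (w, w) (v, 0) = _
  -- The form in the chart is D₁ of x y⁻¹ restricted to the diagonal, so its derivative is D²(v,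
  -- v)(w, 0). After splitting (v, v), the pure part D²(v, 0)(w, 0) is symmetric and cancels in the
  -- antisymmetrization; only mixed derivatives survive.
  have e : ∀ v : V, ((v, v) : V × V) = (v, 0) + (0, v) := by simp
  have c1 : D (0, v) (w, 0) = -mulCross I K (rightForm I k w) (rightForm I k v) :=
    (hsym _ _).trans (crossDeriv_divInChart I k w v)
  have c2 : D (0, w) (v, 0) = -mulCross I K (rightForm I k v) (rightForm I k w) :=
    (hsym _ _).trans (crossDeriv_divInChart I k v w)
  rw [e v, e w, map_add, map_add, add_apply, add_apply,
    c1, c2, hsym (v, 0) (w, 0)]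
  simp only [lieBilin, sub_apply, ContinuousLinearMap.flip_apply]
  abel

end MaurerCartan

/-! ### The canonical symplectic form of the right-trivialized cotangent bundle -/

section TwoForm

open Filter Topology

variable {V : Type*} [NormedAddCommGroup V] [NormedSpace ℝ V] {S : Type*} [TopologicalSpace S]
  (I : ModelWithCorners ℝ V S) [I.Boundaryless] {K : Type*} [TopologicalSpace K]
  [ChartedSpace S K] [Group K]

omit [I.Boundaryless] [Group K] in
lemma extChartAt_cotangent_symm (p : TrivCotangent (V := V) K) (y : StrongDual ℝ V × V) :
    (extChartAt (cotangentModel I) p).symm y = (y.1, (extChartAt I p.2).symm y.2) := by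
  rw [extChartAt_prod]; rfl

omit [I.Boundaryless] [Group K] in
lemma extChartAt_cotangent (p q : TrivCotangent (V := V) K) :
    extChartAt (cotangentModel I) p q = (q.1, extChartAt I p.2 q.2) := by
  rw [extChartAt_prod]; rfl

variable [LieGroup I ∞ K]

/-- The canonical one-form, read in a chart. -/
lemma oneFormInChart_canonicalOneForm (p : TrivCotangent (V := V) K) {y : StrongDual ℝ V × V}
    (hy : y.2 ∈ (extChartAt I p.2).target)
    (hd : DifferentiableAt ℝ (divInChart I p.2) (y.2, y.2)) :
    oneFormInChart (J := cotangentModel I) (canonicalOneForm I) p y =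
      (y.1.comp (rightFormInChart I p.2 y.2)).comp
        (ContinuousLinearMap.snd ℝ (StrongDual ℝ V) V) := by
  have := isManifold_one_of_lieGroup I (K := K)
  have : IsManifold (cotangentModel I) 1 (TrivCotangent (V := V) K) := inferInstance
  have hy' : y ∈ (extChartAt (cotangentModel I) p).target := by
    rw [extChartAt_prod]; exact ⟨by rw [extChartAt_model_space_eq_id]; exact Set.mem_univ _, hy⟩
  let q := (extChartAt (cotangentModel I) p).symm y
  have hq2 : q.2 = (extChartAt I p.2).symm y.2 := by
    simp only [q, extChartAt_cotangent_symm]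
  have hq1 : q.1 = y.1 := by simp only [q, extChartAt_cotangent_symm]
  have h1 : HasMFDerivAt 𝓘(ℝ, StrongDual ℝ V × V) (cotangentModel I)
      (extChartAt (cotangentModel I) p).symm y
      (mfderivWithin 𝓘(ℝ, StrongDual ℝ V × V) (cotangentModel I)
        (extChartAt (cotangentModel I) p).symm (Set.range (cotangentModel I)) y) := by
    have := (mdifferentiableWithinAt_extChartAt_symm hy').hasMFDerivWithinAt
    simp only [ModelWithCorners.range_eq_univ] at this ⊢
    exact hasMFDerivWithinAt_univ.1 this
  have h2 : HasMFDerivAt (cotangentModel I) I (Prod.snd : TrivCotangent (V := V) K → K) q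
      (mfderiv (cotangentModel I) I Prod.snd q) := mdifferentiableAt_snd.hasMFDerivAt
  have h3 : HasMFDerivAt I I (fun x : K => x * q.2⁻¹) q.2
      (mfderiv I I (fun x : K => x * q.2⁻¹) q.2) :=
    (mdiffAt_mul_right I _ _).hasMFDerivAt
  have h4 := h3.comp y (h2.comp y h1)
  have h5 := mfderiv_eq_fderiv_inChart (IB := 𝓘(ℝ, StrongDual ℝ V × V)) (IC := I)
    (g := (fun x : K => x * q.2⁻¹) ∘ Prod.snd ∘ (extChartAt (cotangentModel I) p).symm)
    (b := y) (c := 1) (mul_inv_cancel q.2) h4.mdifferentiableAt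
  -- The divisor `q.2` is frozen at the very point where the derivative is taken, which is why the
  -- derivative in the first slot on the diagonal appears.
  have h6 : fderiv ℝ (fun z : StrongDual ℝ V × V => extChartAt I (1 : K)
      ((extChartAt I p.2).symm z.2 * q.2⁻¹)) y =
      (rightFormInChart I p.2 y.2).comp (ContinuousLinearMap.snd ℝ (StrongDual ℝ V) V) := by
    rw [hq2]
    exact (HasFDerivAt.comp y (g := fun x => divInChart I p.2 (x, y.2)) (hasFDerivAt_fst_slot hd)
      hasFDerivAt_snd).fderiv
  have h7 : (fun z : StrongDual ℝ V × V => extChartAt I (1 : K)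
      ((extChartAt I p.2).symm z.2 * q.2⁻¹)) = fun z : StrongDual ℝ V × V =>
      extChartAt I (1 : K) (((extChartAt (cotangentModel I) p).symm z).2 * q.2⁻¹) := by
    ext z; rw [extChartAt_cotangent_symm]
  have h8 := h4.mfderiv.symm.trans h5
  have h9 : oneFormInChart (J := cotangentModel I) (canonicalOneForm I) p y =
    q.1.comp (fderiv ℝ (fun z : StrongDual ℝ V × V =>
      extChartAt I (1 : K) (((extChartAt (cotangentModel I) p).symm z).2 * q.2⁻¹)) y) :=
    congrArg (fun L : (StrongDual ℝ V × V) →L[ℝ] V => q.1.comp L) h8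
  rw [h9, ← h7, h6, hq1]
  rfl

/-- The canonical symplectic form in terms of the right Maurer-Cartan form. -/
theorem canonicalTwoForm_eq (p : TrivCotangent (V := V) K) (β₁ β₂ : StrongDual ℝ V) (w₁ w₂ : V) :
    canonicalTwoForm I p (β₁, w₁) (β₂, w₂) =
      β₂ (rightForm I p.2 w₁) - β₁ (rightForm I p.2 w₂) -
        p.1 (lieBilin I K (rightForm I p.2 w₁) (rightForm I p.2 w₂)) := by
  have := isManifold_one_of_lieGroup I (K := K)
  have : IsManifold (cotangentModel I) 1 (TrivCotangent (V := V) K) := inferInstance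
  let y₀ : StrongDual ℝ V × V := (p.1, extChartAt I p.2 p.2)
  obtain ⟨L, hL, hMC⟩ := maurerCartan I p.2
  have hev : oneFormInChart (J := cotangentModel I) (canonicalOneForm I) p =ᶠ[𝓝 y₀]
      fun y => (y.1.comp (rightFormInChart I p.2 y.2)).comp
        (ContinuousLinearMap.snd ℝ (StrongDual ℝ V) V) := by
    have hd := (contDiffAt_divInChart I p.2).eventually_differentiableAt
    have hc : ContinuousAt (fun y : StrongDual ℝ V × V => (y.2, y.2)) y₀ := by fun_prop
    have hs : ContinuousAt (fun y : StrongDual ℝ V × V => y.2) y₀ := by fun_prop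
    filter_upwards [hc.eventually hd, hs.eventually (extChartAt_target_mem_nhds (I := I) p.2)]
      with y h1 h2
    exact oneFormInChart_canonicalOneForm I p h2 h1
  have hD : HasFDerivAt (fun y : StrongDual ℝ V × V => (y.1.comp (rightFormInChart I p.2 y.2)).comp
        (ContinuousLinearMap.snd ℝ (StrongDual ℝ V) V)) _ y₀ :=
    HasFDerivAt.clm_comp
      (HasFDerivAt.clm_comp (hasFDerivAt_fst (𝕜 := ℝ) (p := y₀))
        (HasFDerivAt.comp y₀ (g := rightFormInChart I p.2) hL hasFDerivAt_snd))
      (hasFDerivAt_const _ _)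
  have hD2 := (hD.congr_of_eventuallyEq hev).fderiv
  -- Tangent vectors at p are represented in the chart at p, so its tangent map does not change
  -- them.
  have hT : ∀ v : StrongDual ℝ V × V, (mfderiv (cotangentModel I) 𝓘(ℝ, StrongDual ℝ V × V)
      (extChartAt (cotangentModel I) p) p v : StrongDual ℝ V × V) = v := fun v =>
    congrArg (fun T : (StrongDual ℝ V × V) →L[ℝ] (StrongDual ℝ V × V) => T v)
      (mfderiv_extChartAt_self (I := cotangentModel I) (x := p))
  -- Product rule for (μ, x) ↦ μ ∘ ω_x: one term varies the covector, the other varies ω through its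
  -- derivative L. Only the antisymmetrization of L enters Ω, and `hMC` evaluates it.
  have hval : ∀ v w : StrongDual ℝ V × V,
      fderivWithin ℝ (oneFormInChart (J := cotangentModel I) (canonicalOneForm I) p)
        (Set.range (cotangentModel I)) (extChartAt (cotangentModel I) p p) v w =
      v.1 (rightForm I p.2 w.2) + p.1 (L v.2 w.2) := by
    intro v w
    rw [ModelWithCorners.range_eq_univ, fderivWithin_univ, extChartAt_cotangent]
    refine (congrArg (fun D : (StrongDual ℝ V × V) →L[ℝ] (StrongDual ℝ V × V) →L[ℝ] ℝ => D v w)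
      hD2).trans ?_
    rw [← rightFormInChart_self I p.2]
    simp [y₀, add_comm]
  have hfin : canonicalTwoForm I p (β₁, w₁) (β₂, w₂) =
      -((β₁ (rightForm I p.2 w₂) + p.1 (L w₁ w₂)) - (β₂ (rightForm I p.2 w₁) + p.1 (L w₂ w₁))) := by
    have e := congrArg₂ (fun a b : ℝ => -(a - b)) (hval (β₁, w₁) (β₂, w₂)) (hval (β₂, w₂) (β₁, w₁))
    refine Eq.trans ?_ e
    have h1 := hT (β₁, w₁)
    have h2 := hT (β₂, w₂)
    unfold canonicalTwoForm extDerivOneForm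
    exact congrArg₂ (fun a b : StrongDual ℝ V × V =>
      -(fderivWithin ℝ (oneFormInChart (J := cotangentModel I) (canonicalOneForm I) p)
        (Set.range (cotangentModel I)) (extChartAt (cotangentModel I) p p) a b -
        fderivWithin ℝ (oneFormInChart (J := cotangentModel I) (canonicalOneForm I) p)
        (Set.range (cotangentModel I)) (extChartAt (cotangentModel I) p p) b a)) h1 h2
  rw [hfin, ← hMC, map_sub]
  ring

end TwoForm

/-! ### Partial derivatives on a product manifold -/

section Slots

variable {VA : Type*} [NormedAddCommGroup VA] [NormedSpace ℝ VA] {SA : Type*} [TopologicalSpace SA]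
  {IA : ModelWithCorners ℝ VA SA} {A : Type*} [TopologicalSpace A] [ChartedSpace SA A]
  {VB : Type*} [NormedAddCommGroup VB] [NormedSpace ℝ VB] {SB : Type*} [TopologicalSpace SB]
  {IB : ModelWithCorners ℝ VB SB} {B : Type*} [TopologicalSpace B] [ChartedSpace SB B]
  {VC : Type*} [NormedAddCommGroup VC] [NormedSpace ℝ VC] {SC : Type*} [TopologicalSpace SC]
  {IC : ModelWithCorners ℝ VC SC} {C : Type*} [TopologicalSpace C] [ChartedSpace SC C]

lemma mfderiv_fst_slot {f : A × B → C} {a : A} {b : B}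
    (hf : MDifferentiableAt (IA.prod IB) IC f (a, b)) (v : VA) :
    (mfderiv (IA.prod IB) IC f (a, b) ((v, 0) : VA × VB) : VC) =
      mfderiv IA IC (fun x => f (x, b)) a v := by
  have h : MDifferentiableAt IA (IA.prod IB) (fun x : A => (x, b)) a :=
    mdifferentiableAt_id.prodMk mdifferentiableAt_const
  have h1 := mfderiv_comp_apply a hf h v
  refine Eq.trans ?_ h1.symm
  have h2 : (mfderiv IA (IA.prod IB) (fun x : A => (x, b)) a v : VA × VB) = (v, 0) :=
    congrArg (fun L : VA →L[ℝ] VA × VB => L v) mfderiv_prod_left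
  exact (congrArg (fun t : VA × VB => (mfderiv (IA.prod IB) IC f (a, b) t : VC)) h2).symm

lemma mfderiv_snd_slot {f : A × B → C} {a : A} {b : B}
    (hf : MDifferentiableAt (IA.prod IB) IC f (a, b)) (w : VB) :
    (mfderiv (IA.prod IB) IC f (a, b) ((0, w) : VA × VB) : VC) =
      mfderiv IB IC (fun y => f (a, y)) b w := by
  have h : MDifferentiableAt IB (IA.prod IB) (fun y : B => (a, y)) b :=
    mdifferentiableAt_const.prodMk mdifferentiableAt_id
  have h1 := mfderiv_comp_apply b hf h w
  refine Eq.trans ?_ h1.symm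
  have h2 : (mfderiv IB (IA.prod IB) (fun y : B => (a, y)) b w : VA × VB) = (0, w) :=
    congrArg (fun L : VB →L[ℝ] VA × VB => L w) mfderiv_prod_right
  exact (congrArg (fun t : VA × VB => (mfderiv (IA.prod IB) IC f (a, b) t : VC)) h2).symm

lemma mfderiv_prodMk_apply {f : A × B → C} {a : A} {b : B}
    (hf : MDifferentiableAt (IA.prod IB) IC f (a, b)) (v : VA) (w : VB) :
    (mfderiv (IA.prod IB) IC f (a, b) ((v, w) : VA × VB) : VC) =
      (mfderiv IA IC (fun x => f (x, b)) a v : VC) + mfderiv IB IC (fun y => f (a, y)) b w := by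
  have e : ((v, w) : VA × VB) = (v, 0) + (0, w) := by simp
  have h : (mfderiv (IA.prod IB) IC f (a, b) ((v, w) : VA × VB) : VC) =
      (mfderiv (IA.prod IB) IC f (a, b) : VA × VB →L[ℝ] VC) ((v, 0) + (0, w)) :=
    congrArg (mfderiv (IA.prod IB) IC f (a, b) : VA × VB →L[ℝ] VC) e
  exact (h.trans (map_add (mfderiv (IA.prod IB) IC f (a, b) : VA × VB →L[ℝ] VC) _ _)).trans
    (congrArg₂ (fun s t : VC => s + t) (mfderiv_fst_slot hf v) (mfderiv_snd_slot hf w))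

lemma mdifferentiableAt_fst_slot {f : A × B → C} {a : A} {b : B}
    (hf : MDifferentiableAt (IA.prod IB) IC f (a, b)) :
    MDifferentiableAt IA IC (fun x => f (x, b)) a :=
  MDifferentiableAt.comp a hf (mdifferentiableAt_id.prodMk mdifferentiableAt_const)

lemma mdifferentiableAt_snd_slot {f : A × B → C} {a : A} {b : B}
    (hf : MDifferentiableAt (IA.prod IB) IC f (a, b)) :
    MDifferentiableAt IB IC (fun y => f (a, y)) b :=
  MDifferentiableAt.comp b hf (mdifferentiableAt_const.prodMk mdifferentiableAt_id)

end Slots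

/-! ### Functional derivatives on the dual of a reflexive space -/

section Reflexive

variable {V W : Type*} [NormedAddCommGroup V] [NormedSpace ℝ V] [NormedAddCommGroup W]
  [NormedSpace ℝ W]

/-- Reflexivity makes the `invFun` in `functionalDeriv` a genuine preimage of the derivative, which
is an element of the bidual. -/
lemma apply_functionalDeriv (hV : Function.Surjective (inclusionInDoubleDual ℝ V))
    (f : StrongDual ℝ V → ℝ) (μ β : StrongDual ℝ V) :
    β (functionalDeriv f μ) = fderiv ℝ f μ β := by
  have h := Function.invFun_eq (hV (fderiv ℝ f μ))
  exact congrArg (fun L : StrongDual ℝ (StrongDual ℝ V) => L β) h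

lemma eq_of_forall_dual_apply {x y : V} (h : ∀ β : StrongDual ℝ V, β x = β y) : x = y :=
  (SeparatingDual.eq_iff_forall_dual_eq (R := ℝ)).2 h

lemma eq_functionalDeriv (hV : Function.Surjective (inclusionInDoubleDual ℝ V))
    {f : StrongDual ℝ V → ℝ} {μ : StrongDual ℝ V} {x : V} (h : ∀ β, β x = fderiv ℝ f μ β) :
    x = functionalDeriv f μ :=
  eq_of_forall_dual_apply fun β => by rw [h, apply_functionalDeriv hV]

/-- A product of reflexive spaces is reflexive. -/
lemma surjective_inclusionInDoubleDual_prod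
    (hV : Function.Surjective (inclusionInDoubleDual ℝ V))
    (hW : Function.Surjective (inclusionInDoubleDual ℝ W)) :
    Function.Surjective (inclusionInDoubleDual ℝ (V × W)) := by
  intro Φ
  obtain ⟨x, hx⟩ := hV (Φ.comp ((ContinuousLinearMap.compL ℝ (V × W) V ℝ).flip
    (ContinuousLinearMap.fst ℝ V W)))
  obtain ⟨y, hy⟩ := hW (Φ.comp ((ContinuousLinearMap.compL ℝ (V × W) W ℝ).flip
    (ContinuousLinearMap.snd ℝ V W)))
  refine ⟨(x, y), ContinuousLinearMap.ext fun β => ?_⟩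
  have h1 := congrArg (fun L : StrongDual ℝ (StrongDual ℝ V) =>
    L (β.comp (ContinuousLinearMap.inl ℝ V W))) hx
  have h2 := congrArg (fun L : StrongDual ℝ (StrongDual ℝ W) =>
    L (β.comp (ContinuousLinearMap.inr ℝ V W))) hy
  have e : β = (β.comp (ContinuousLinearMap.inl ℝ V W)).comp (ContinuousLinearMap.fst ℝ V W) +
      (β.comp (ContinuousLinearMap.inr ℝ V W)).comp (ContinuousLinearMap.snd ℝ V W) := by
    ext <;> simp [← Prod.zero_eq_mk]
  rw [NormedSpace.dual_def]
  change β (x, 0) = Φ ((β.comp (ContinuousLinearMap.inl ℝ V W)).comp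
    (ContinuousLinearMap.fst ℝ V W)) at h1
  change β (0, y) = Φ ((β.comp (ContinuousLinearMap.inr ℝ V W)).comp
    (ContinuousLinearMap.snd ℝ V W)) at h2
  conv_rhs => rw [e, map_add, ← h1, ← h2]
  rw [← map_add]; simp

end Reflexive

/-! ### The canonical Poisson bracket of the right-trivialized cotangent bundle -/

section Poisson

variable {V : Type*} [NormedAddCommGroup V] [NormedSpace ℝ V] {S : Type*} [TopologicalSpace S]
  (I : ModelWithCorners ℝ V S) [I.Boundaryless] {K : Type*} [TopologicalSpace K]
  [ChartedSpace S K] [Group K] [LieGroup I ∞ K]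

omit [I.Boundaryless] [LieGroup I ∞ K] in
lemma lieBilin_swap (v w : V) : lieBilin I K v w = -lieBilin I K w v := by
  simp [lieBilin]

/-- The canonical symplectic form in the right trivialization. -/
lemma canonicalTwoForm_tangentRight (p : TrivCotangent (V := V) K) (β₁ β₂ : StrongDual ℝ V)
    (ξ₁ ξ₂ : V) :
    canonicalTwoForm I p (β₁, tangentRight I p.2 ξ₁) (β₂, tangentRight I p.2 ξ₂) =
      β₂ ξ₁ - β₁ ξ₂ - p.1 (lieBilin I K ξ₁ ξ₂) := by
  rw [canonicalTwoForm_eq, rightForm_tangentRight, rightForm_tangentRight]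

/-- The covector with which a tangent vector is paired by the canonical symplectic form. -/
lemma forall_canonicalTwoForm_eq_iff (p : TrivCotangent (V := V) K) (β : StrongDual ℝ V) (ξ : V)
    (l : StrongDual ℝ V × V →L[ℝ] ℝ) :
    (∀ w : TangentSpace (cotangentModel I) p,
      canonicalTwoForm I p (β, tangentRight I p.2 ξ) w = l w) ↔
    (∀ β' : StrongDual ℝ V, β' ξ = l (β', 0)) ∧
      ∀ y, β y = -l (0, tangentRight I p.2 y) - p.1 (lieBilin I K ξ y) := by
  constructor
  -- Fibre directions (β', 0) test ξ alone; base directions (0, T R y) then determine β.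
  · refine fun h => ⟨fun β' => ?_, fun y => ?_⟩
    · have h1 := canonicalTwoForm_tangentRight I p β β' ξ 0
      have h2 : canonicalTwoForm I p (β, tangentRight I p.2 ξ) (β', tangentRight I p.2 0) =
        l (β', tangentRight I p.2 0) := h _
      rw [h1] at h2
      simpa using h2
    · have h1 := canonicalTwoForm_tangentRight I p β 0 ξ y
      have h2 : canonicalTwoForm I p (β, tangentRight I p.2 ξ) (0, tangentRight I p.2 y) =
        l (0, tangentRight I p.2 y) := h _
      rw [h1] at h2
      rw [← h2, zero_apply]
      ring
  -- Every base vector v equals T R applied to `rightForm I p.2 v`, so fibre and base tests suffice.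
  · rintro ⟨h1, h2⟩ w
    obtain ⟨β', v⟩ : StrongDual ℝ V × V := w
    have h3 := canonicalTwoForm_tangentRight I p β β' ξ (rightForm I p.2 v)
    rw [tangentRight_rightForm] at h3
    refine h3.trans ?_
    have e : ((β', v) : StrongDual ℝ V × V) = (β', 0) + (0, v) := by simp
    have h4 : l (β', v) = l (β', 0) + l (0, v) := by rw [e, map_add]
    rw [h2, h1, tangentRight_rightForm]
    refine Eq.trans ?_ h4.symm
    ring

/-- The canonical symplectic form on the cotangent bundle of a Lie group modelled on a reflexive
space is strongly nondegenerate. -/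
theorem existsUnique_canonicalTwoForm_eq (hV : Function.Surjective (inclusionInDoubleDual ℝ V))
    (p : TrivCotangent (V := V) K) (l : TangentSpace (cotangentModel I) p →L[ℝ] ℝ) :
    ∃! X : TangentSpace (cotangentModel I) p, ∀ w, canonicalTwoForm I p X w = l w := by
  let l' : StrongDual ℝ V × V →L[ℝ] ℝ := l
  -- Reflexivity enters here: the restriction of the covector to the fibre 𝔨* is evaluation at a
  -- vector ξ.
  obtain ⟨ξ, hξ⟩ := hV (l'.comp (ContinuousLinearMap.inl ℝ (StrongDual ℝ V) V))
  have hξ' : ∀ β' : StrongDual ℝ V, β' ξ = l' (β', 0) := fun β' =>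
    congrArg (fun L : StrongDual ℝ (StrongDual ℝ V) => L β') hξ
  let β : StrongDual ℝ V :=
    -(l'.comp ((ContinuousLinearMap.inr ℝ (StrongDual ℝ V) V).comp (tangentRight I p.2))) -
      p.1.comp (lieBilin I K ξ)
  refine ⟨((β, tangentRight I p.2 ξ) : StrongDual ℝ V × V),
    (forall_canonicalTwoForm_eq_iff I p β ξ l').2 ⟨hξ', fun y => rfl⟩, ?_⟩
  intro Y hY
  obtain ⟨β', v⟩ : StrongDual ℝ V × V := Y
  have hY' : ∀ w : TangentSpace (cotangentModel I) p,
      canonicalTwoForm I p (β', tangentRight I p.2 (rightForm I p.2 v)) w = l' w := by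
    rw [tangentRight_rightForm]; exact hY
  obtain ⟨h1, h2⟩ := (forall_canonicalTwoForm_eq_iff I p β' (rightForm I p.2 v) l').1 hY'
  have e : rightForm I p.2 v = ξ :=
    eq_of_forall_dual_apply fun β' => (h1 β').trans (hξ' β').symm
  have e2 : β' = β := by
    ext y
    rw [h2, e]
    rfl
  have e3 : v = tangentRight I p.2 ξ := by rw [← e, tangentRight_rightForm]
  exact Prod.ext e2 e3

/-- The partial derivative along the base of a function on the right-trivialized cotangent
bundle. -/
def baseDeriv (f : TrivCotangent (V := V) K → ℝ) (α : StrongDual ℝ V) (k : K) : V →L[ℝ] ℝ :=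
  (mfderiv I 𝓘(ℝ, ℝ) (fun k' => f (α, k')) k : TangentSpace I k →L[ℝ] ℝ)

/-- The canonical Poisson bracket in the right trivialization. -/
theorem canonicalPoisson_eq (hV : Function.Surjective (inclusionInDoubleDual ℝ V))
    {f₁ f₂ : TrivCotangent (V := V) K → ℝ} {α : StrongDual ℝ V} {k : K}
    (h₁ : MDifferentiableAt (cotangentModel I) 𝓘(ℝ, ℝ) f₁ (α, k))
    (h₂ : MDifferentiableAt (cotangentModel I) 𝓘(ℝ, ℝ) f₂ (α, k)) :
    canonicalPoisson I f₁ f₂ (α, k) =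
      baseDeriv I f₁ α k
          (tangentRight I k (functionalDeriv (fun α' => f₂ (α', k)) α)) -
        baseDeriv I f₂ α k
          (tangentRight I k (functionalDeriv (fun α' => f₁ (α', k)) α)) +
        α (lieBilin I K (functionalDeriv (fun α' => f₁ (α', k)) α)
          (functionalDeriv (fun α' => f₂ (α', k)) α)) := by
  have key : ∀ f : TrivCotangent (V := V) K → ℝ,
      MDifferentiableAt (cotangentModel I) 𝓘(ℝ, ℝ) f (α, k) →
      ∃ β : StrongDual ℝ V,
        hamiltonianVector I f (α, k) =
          ((β, tangentRight I k (functionalDeriv (fun α' => f (α', k)) α)) :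
            StrongDual ℝ V × V) ∧
        ∀ y, β y = -baseDeriv I f α k (tangentRight I k y) -
          α (lieBilin I K (functionalDeriv (fun α' => f (α', k)) α) y) := by
    intro f hf
    let l : StrongDual ℝ V × V →L[ℝ] ℝ := mfderiv (cotangentModel I) 𝓘(ℝ, ℝ) f (α, k)
    -- By strong nondegeneracy the choice in `hamiltonianVector` does solve the Hamiltonian
    -- equation.
    have hs : IsHamiltonianVector I f (α, k) (hamiltonianVector I f (α, k)) :=
      Classical.epsilon_spec (existsUnique_canonicalTwoForm_eq I hV (α, k) l).exists
    obtain ⟨⟨β, v⟩, hX⟩ : ∃ X : StrongDual ℝ V × V, hamiltonianVector I f (α, k) = X := ⟨_, rfl⟩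
    rw [hX] at hs
    have hs' : ∀ w : TangentSpace (cotangentModel I) ((α, k) : TrivCotangent (V := V) K),
        canonicalTwoForm I ((α, k) : TrivCotangent (V := V) K)
          (β, tangentRight I k (rightForm I k v)) w = l w := by
      rw [tangentRight_rightForm]; exact hs
    obtain ⟨h1, h2⟩ := (forall_canonicalTwoForm_eq_iff I (α, k) β (rightForm I k v) l).1 hs'
    have e : rightForm I k v = functionalDeriv (fun α' => f (α', k)) α := by
      refine eq_functionalDeriv hV fun β' => ?_
      refine (h1 β').trans ((mfderiv_fst_slot hf β').trans ?_)
      exact congrArg (fun L : StrongDual ℝ V →L[ℝ] ℝ => L β') mfderiv_eq_fderiv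
    refine ⟨β, ?_, fun y => ?_⟩
    · rw [hX, ← e, tangentRight_rightForm]
    · rw [h2, e]
      exact congrArg (fun t : ℝ => -t - _) (mfderiv_snd_slot hf _)
  obtain ⟨β₁, e₁, hβ₁⟩ := key f₁ h₁
  obtain ⟨β₂, e₂, hβ₂⟩ := key f₂ h₂
  have h := canonicalTwoForm_tangentRight I ((α, k) : TrivCotangent (V := V) K) β₁ β₂
    (functionalDeriv (fun α' => f₁ (α', k)) α) (functionalDeriv (fun α' => f₂ (α', k)) α)
  rw [canonicalPoisson, e₁, e₂]
  refine h.trans ?_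
  -- With ξᵢ the functional derivatives, the terms β₂ξ₁ and -β₁ξ₂ each contribute +α([ξ₁, ξ₂]), and
  -- the symplectic form contributes one with a minus sign: one copy remains.
  rw [hβ₁, hβ₂, lieBilin_swap I (functionalDeriv (fun α' => f₂ (α', k)) α), map_neg]
  ring

end Poisson

/-! ### The Lie algebra of a matched pair group -/

section

open Filter Topology

variable {VA : Type*} [NormedAddCommGroup VA] [NormedSpace ℝ VA]
  {VB : Type*} [NormedAddCommGroup VB] [NormedSpace ℝ VB] {SB : Type*} [TopologicalSpace SB]
  {IB : ModelWithCorners ℝ VB SB} {B : Type*} [TopologicalSpace B] [ChartedSpace SB B]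
  {VC : Type*} [NormedAddCommGroup VC] [NormedSpace ℝ VC] {SC : Type*} [TopologicalSpace SC]
  {IC : ModelWithCorners ℝ VC SC} {C : Type*} [TopologicalSpace C] [ChartedSpace SC C]

/-- The tangent map of a family of linear maps, evaluated at a vector, computed in a chart. -/
lemma mfderiv_clm_apply_eq [IB.Boundaryless] [IsManifold IB 1 B] {D : VB → VA →L[ℝ] VC}
    {D' : VB →L[ℝ] VA →L[ℝ] VC} {L : B → VA →L[ℝ] VC} {b : B}
    (hD : HasFDerivAt D D' (extChartAt IB b b)) (hL : ∀ᶠ x in 𝓝 b, L x = D (extChartAt IB b x))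
    (η : VB) (ξ : VA) :
    (mfderiv IB 𝓘(ℝ, VC) (fun x => L x ξ) b η : VC) = D' η ξ := by
  have h1 : HasFDerivAt (fun y => D y ξ) (D'.flip ξ) (extChartAt IB b b) :=
    (hD.clm_apply (hasFDerivAt_const ξ _)).congr_fderiv (by ext; simp)
  have h2 : MDifferentiableAt IB 𝓘(ℝ, VC) (fun x => L x ξ) b := by
    have h3 : MDifferentiableAt IB 𝓘(ℝ, VC) ((fun y => D y ξ) ∘ extChartAt IB b) b :=
      MDifferentiableAt.comp b h1.differentiableAt.mdifferentiableAt
        (mdifferentiableAt_extChartAt (mem_chart_source SB b))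
    refine h3.congr_of_eventuallyEq ?_
    filter_upwards [hL] with x hx
    rw [hx]; rfl
  have h4 := mfderiv_eq_fderiv_inChart (IB := IB) (g := fun x => L x ξ) (b := b) (c := L b ξ) rfl h2
  have h5 : (fun y => extChartAt 𝓘(ℝ, VC) (L b ξ) (L ((extChartAt IB b).symm y) ξ))
      =ᶠ[𝓝 (extChartAt IB b b)] fun y => D y ξ := by
    have h6 : Tendsto (extChartAt IB b).symm (𝓝 (extChartAt IB b b)) (𝓝 b) := by
      have := continuousAt_extChartAt_symm (I := IB) b
      rwa [ContinuousAt, extChartAt_to_inv] at this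
    filter_upwards [h6.eventually hL, extChartAt_target_mem_nhds (I := IB) b] with y hy hy'
    rw [hy, (extChartAt IB b).right_inv hy']
    rfl
  rw [(h1.congr_of_eventuallyEq h5).fderiv] at h4
  exact congrArg (fun T : VB →L[ℝ] VC => T η) h4

lemma mfderiv_congr_apply {f f' : B → C} (h : f = f') (b : B) (v : VB) :
    (mfderiv IB IC f b v : VC) = mfderiv IB IC f' b v := by
  subst h; rfl

end

namespace MatchedPair

open Filter Topology

variable {E F : Type*} [NormedAddCommGroup E] [NormedSpace ℝ E]
  [NormedAddCommGroup F] [NormedSpace ℝ F]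
  {G : Type*} [TopologicalSpace G] [ChartedSpace E G] [Group G] [LieGroup 𝓘(ℝ, E) ∞ G]
  {H : Type*} [TopologicalSpace H] [ChartedSpace F H] [Group H] [LieGroup 𝓘(ℝ, F) ∞ H]
  (M : MatchedPair (E := E) (F := F) G H)

/-- The action `ρ` in the charts at the units. -/
def ρInChart : F × E → E := inCharts 𝓘(ℝ, F) 𝓘(ℝ, E) 𝓘(ℝ, E) M.ρ 1 1 1

/-- The action `σ` in the charts at the units. -/
def σInChart : F × E → F := inCharts 𝓘(ℝ, F) 𝓘(ℝ, E) 𝓘(ℝ, F) M.σ 1 1 1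

/-- The unit of `G`, read in the chart. -/
def unitG (_M : MatchedPair (E := E) (F := F) G H) : E := extChartAt 𝓘(ℝ, E) (1 : G) 1

/-- The unit of `H`, read in the chart. -/
def unitH (_M : MatchedPair (E := E) (F := F) G H) : F := extChartAt 𝓘(ℝ, F) (1 : H) 1

lemma contDiffAt_ρInChart : ContDiffAt ℝ 2 M.ρInChart (M.unitH, M.unitG) :=
  (contDiffAt_inCharts (n := ∞) M.contMDiff_ρ.contMDiffAt (by simp [M.ρ_one])).of_le
    (WithTop.coe_le_coe.2 le_top)

lemma contDiffAt_σInChart : ContDiffAt ℝ 2 M.σInChart (M.unitH, M.unitG) :=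
  (contDiffAt_inCharts (n := ∞) M.contMDiff_σ.contMDiffAt (by simp [M.σ_one])).of_le
    (WithTop.coe_le_coe.2 le_top)

lemma mdifferentiableAt_ρ_right (h : H) (g : G) :
    MDifferentiableAt 𝓘(ℝ, E) 𝓘(ℝ, E) (fun g => M.ρ h g) g :=
  mdifferentiableAt_snd_slot (M.contMDiff_ρ.mdifferentiableAt (by simp) (x := (h, g)))

lemma mdifferentiableAt_ρ_left (h : H) (g : G) :
    MDifferentiableAt 𝓘(ℝ, F) 𝓘(ℝ, E) (fun h => M.ρ h g) h :=
  mdifferentiableAt_fst_slot (M.contMDiff_ρ.mdifferentiableAt (by simp) (x := (h, g)))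

lemma mdifferentiableAt_σ_left (h : H) (g : G) :
    MDifferentiableAt 𝓘(ℝ, F) 𝓘(ℝ, F) (fun h => M.σ h g) h :=
  mdifferentiableAt_fst_slot (M.contMDiff_σ.mdifferentiableAt (by simp) (x := (h, g)))

/-- Since h ▷ 1 = 1, each map g ↦ h ▷ g has source and target point 1. Its tangent map is therefore
read in fixed charts as h varies, and differentiating in h gives D₁ D₂. -/
lemma lieρ_eq_crossDeriv (η : F) (ξ : E) :
    M.lieρ η ξ = crossDeriv M.ρInChart (M.unitH, M.unitG) η ξ := by
  have := isManifold_one_of_lieGroup 𝓘(ℝ, F) (K := H)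
  refine mfderiv_clm_apply_eq (IB := 𝓘(ℝ, F)) (B := H)
    (hasFDerivAt_fderiv_snd_slot M.contDiffAt_ρInChart) ?_ η ξ
  filter_upwards [extChartAt_source_mem_nhds (I := 𝓘(ℝ, F)) (1 : H)] with h hh
  refine (mfderiv_eq_fderiv_inChart (M.ρ_one h) (M.mdifferentiableAt_ρ_right h 1)).trans ?_
  simp only [ρInChart, inCharts, (extChartAt 𝓘(ℝ, F) (1 : H)).left_inv hh]
  rfl

/-- Here the H-variable is differentiated first, with target chart fixed because 1 ◁ g = 1. This
gives D₂ D₁, which equals the transpose of D₁ D₂ by symmetry. -/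
lemma lieσ_eq_crossDeriv (η : F) (ξ : E) :
    M.lieσ η ξ = crossDeriv M.σInChart (M.unitH, M.unitG) η ξ := by
  have := isManifold_one_of_lieGroup 𝓘(ℝ, E) (K := G)
  refine mfderiv_clm_apply_eq (IB := 𝓘(ℝ, E)) (B := G)
    (hasFDerivAt_fderiv_fst_slot M.contDiffAt_σInChart) ?_ ξ η
  filter_upwards [extChartAt_source_mem_nhds (I := 𝓘(ℝ, E)) (1 : G)] with g hg
  refine (mfderiv_eq_fderiv_inChart (g := fun h => M.σ h g) (M.one_σ g)
    (M.mdifferentiableAt_σ_left 1 g)).trans ?_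
  simp only [σInChart, inCharts, (extChartAt 𝓘(ℝ, E) (1 : G)).left_inv hg]
  rfl

/-- The multiplication of `G ⋈ H` in the chart at the unit. -/
lemma mulInChart_bowtie :
    ∀ᶠ z in 𝓝 (((M.unitG, M.unitH), (M.unitG, M.unitH)) : (E × F) × (E × F)),
    mulInChart M.model M.Bowtie z =
      (mulInChart 𝓘(ℝ, E) G (z.1.1, M.ρInChart (z.1.2, z.2.1)),
        mulInChart 𝓘(ℝ, F) H (M.σInChart (z.1.2, z.2.1), z.2.2)) := by
  let z₀ : (E × F) × (E × F) := ((M.unitG, M.unitH), (M.unitG, M.unitH))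
  have hG : ContinuousAt (fun z : (E × F) × (E × F) =>
      (extChartAt 𝓘(ℝ, E) (1 : G)).symm z.2.1) z₀ :=
    ContinuousAt.comp (g := (extChartAt 𝓘(ℝ, E) (1 : G)).symm)
      (continuousAt_extChartAt_symm (1 : G)) (by fun_prop)
  have hH : ContinuousAt (fun z : (E × F) × (E × F) =>
      (extChartAt 𝓘(ℝ, F) (1 : H)).symm z.1.2) z₀ :=
    ContinuousAt.comp (g := (extChartAt 𝓘(ℝ, F) (1 : H)).symm)
      (continuousAt_extChartAt_symm (1 : H)) (by fun_prop)
  have eG : (extChartAt 𝓘(ℝ, E) (1 : G)).symm z₀.2.1 = 1 := extChartAt_to_inv 1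
  have eH : (extChartAt 𝓘(ℝ, F) (1 : H)).symm z₀.1.2 = 1 := extChartAt_to_inv 1
  have hρ := (ContinuousAt.comp (x := z₀) (g := fun x : H × G => M.ρ x.1 x.2)
    M.contMDiff_ρ.continuous.continuousAt (hH.prodMk hG)).eventually
    (p := (· ∈ (extChartAt 𝓘(ℝ, E) (1 : G)).source)) (by
      simp only [Function.comp_def, eG, eH, M.ρ_one]
      exact extChartAt_source_mem_nhds (I := 𝓘(ℝ, E)) (1 : G))
  have hσ := (ContinuousAt.comp (x := z₀) (g := fun x : H × G => M.σ x.1 x.2)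
    M.contMDiff_σ.continuous.continuousAt (hH.prodMk hG)).eventually
    (p := (· ∈ (extChartAt 𝓘(ℝ, F) (1 : H)).source)) (by
      simp only [Function.comp_def, eG, eH, M.σ_one]
      exact extChartAt_source_mem_nhds (I := 𝓘(ℝ, F)) (1 : H))
  filter_upwards [hρ, hσ] with z h1 h2
  simp only [Function.comp_def] at h1 h2
  simp only [mulInChart, inCharts, ρInChart, σInChart]
  rw [(extChartAt 𝓘(ℝ, E) (1 : G)).left_inv h1, (extChartAt 𝓘(ℝ, F) (1 : H)).left_inv h2]
  rfl

lemma ρInChart_unitG (y : F) : M.ρInChart (y, M.unitG) = M.unitG := by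
  simp [ρInChart, inCharts, unitG, M.ρ_one]

lemma ρInChart_unitH : ∀ᶠ x in 𝓝 M.unitG, M.ρInChart (M.unitH, x) = x := by
  filter_upwards [extChartAt_target_mem_nhds (I := 𝓘(ℝ, E)) (1 : G)] with x hx
  simp only [ρInChart, inCharts, unitH, extChartAt_to_inv, M.one_ρ]
  exact (extChartAt 𝓘(ℝ, E) (1 : G)).right_inv hx

lemma σInChart_unitG : ∀ᶠ y in 𝓝 M.unitH, M.σInChart (y, M.unitG) = y := by
  filter_upwards [extChartAt_target_mem_nhds (I := 𝓘(ℝ, F)) (1 : H)] with y hy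
  simp only [σInChart, inCharts, unitG, extChartAt_to_inv, M.σ_one]
  exact (extChartAt 𝓘(ℝ, F) (1 : H)).right_inv hy

/-- Near the unit the product is (m_G(a, ρ(b, a')), m_H(σ(b, a'), b')). Its derivative in (a', b')
at the unit, along w, is (D₂m_G(a, 1) D₂ρ(b, 1)w₁, D₂σ(b, 1)w₁ + D₂m_H(b, 1)w₂). Differentiating
this in (a, b) by the product rule, where D₂m_G(1, 1) and D₂ρ(1, 1) are identities, gives the four
terms. -/
lemma mulCross_bowtie (v w : E × F) :
    mulCross M.model M.Bowtie v w =
      (mulCross 𝓘(ℝ, E) G v.1 w.1 + M.lieρ v.2 w.1,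
        M.lieσ v.2 w.1 + mulCross 𝓘(ℝ, F) H v.2 w.2) := by
  let c : E × F := (M.unitG, M.unitH)
  let mG := mulInChart 𝓘(ℝ, E) G
  let mH := mulInChart 𝓘(ℝ, F) H
  have hmG : ContDiffAt ℝ 2 mG (M.unitG, M.unitG) := contDiffAt_mulInChart 𝓘(ℝ, E) G
  have hmH : ContDiffAt ℝ 2 mH (M.unitH, M.unitH) := contDiffAt_mulInChart 𝓘(ℝ, F) H
  let m : (E × F) × (E × F) → E × F := fun z =>
    (mG (z.1.1, M.ρInChart (z.1.2, z.2.1)), mH (M.σInChart (z.1.2, z.2.1), z.2.2))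
  have hm0 : mulInChart M.model M.Bowtie =ᶠ[𝓝 (c, c)] m := M.mulInChart_bowtie
  have hm : ContDiffAt ℝ 2 m (c, c) :=
    (contDiffAt_mulInChart M.model M.Bowtie).congr_of_eventuallyEq hm0.symm
  have e1 : mulCross M.model M.Bowtie = crossDeriv m (c, c) := crossDeriv_congr hm0
  have h1 := (hasFDerivAt_fderiv_snd_slot hm).clm_apply (hasFDerivAt_const w c)
  -- the partial derivative of the product at the unit
  have h2 : (fun z : E × F => fderiv ℝ (fun z' => m (z, z')) c w) =ᶠ[𝓝 c] fun z =>
      (fderiv ℝ (fun x => mG (z.1, x)) M.unitG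
          (fderiv ℝ (fun x => M.ρInChart (z.2, x)) M.unitG w.1),
        fderiv ℝ (fun x => M.σInChart (z.2, x)) M.unitG w.1 +
          fderiv ℝ (fun y => mH (z.2, y)) M.unitH w.2) := by
    have hfst : Tendsto (Prod.fst : E × F → E) (𝓝 c) (𝓝 M.unitG) := continuousAt_fst
    have hsnd : Tendsto (Prod.snd : E × F → F) (𝓝 c) (𝓝 M.unitH) := continuousAt_snd
    filter_upwards [
      hfst.eventually (eventually_prodMk_left hmG.eventually_differentiableAt),
      hsnd.eventually (eventually_prodMk_left M.contDiffAt_ρInChart.eventually_differentiableAt),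
      hsnd.eventually (eventually_prodMk_left M.contDiffAt_σInChart.eventually_differentiableAt),
      hsnd.eventually (eventually_prodMk_left hmH.eventually_differentiableAt),
      hsnd.eventually M.σInChart_unitG,
      hsnd.eventually (mulInChart_unit_right 𝓘(ℝ, F) H).eventually_nhds]
      with z dG dρ dσ dH eσ eH
    have a1 : HasFDerivAt (fun z' : E × F => M.ρInChart (z.2, z'.1)) _ c :=
      HasFDerivAt.comp c (g := fun x => M.ρInChart (z.2, x))
        (hasFDerivAt_snd_slot dρ).differentiableAt.hasFDerivAt (hasFDerivAt_fst (𝕜 := ℝ))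
    have a2 : HasFDerivAt (fun z' : E × F => mG (z.1, M.ρInChart (z.2, z'.1)))
        ((fderiv ℝ (fun x => mG (z.1, x)) M.unitG).comp
          ((fderiv ℝ (fun x => M.ρInChart (z.2, x)) M.unitG).comp
            (ContinuousLinearMap.fst ℝ E F))) c := by
      refine HasFDerivAt.comp c (g := fun x => mG (z.1, x))
        (g' := fderiv ℝ (fun x => mG (z.1, x)) M.unitG) ?_ a1
      rw [M.ρInChart_unitG]
      exact (hasFDerivAt_snd_slot dG).differentiableAt.hasFDerivAt
    have a3 : HasFDerivAt (fun z' : E × F => M.σInChart (z.2, z'.1)) _ c :=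
      HasFDerivAt.comp c (g := fun x => M.σInChart (z.2, x))
        (hasFDerivAt_snd_slot dσ).differentiableAt.hasFDerivAt (hasFDerivAt_fst (𝕜 := ℝ))
    have a4 : HasFDerivAt (fun z' : E × F => mH (M.σInChart (z.2, z'.1), z'.2))
        ((fderiv ℝ mH (z.2, M.unitH)).comp
          (((fderiv ℝ (fun x => M.σInChart (z.2, x)) M.unitG).comp
            (ContinuousLinearMap.fst ℝ E F)).prod (ContinuousLinearMap.snd ℝ E F))) c := by
      refine HasFDerivAt.comp c (g := mH) (g' := fderiv ℝ mH (z.2, M.unitH)) ?_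
        (a3.prodMk (hasFDerivAt_snd (𝕜 := ℝ)))
      change HasFDerivAt mH _ (M.σInChart (z.2, M.unitG), M.unitH)
      rw [eσ]
      exact dH.hasFDerivAt
    have a5 := (a2.prodMk a4).fderiv
    -- From y · 1 = y: the σ-term enters the second component with coefficient the identity for
    -- every nearby b, so it creates no extra second-order term.
    have a6 : (fderiv ℝ mH (z.2, M.unitH)).comp (ContinuousLinearMap.inl ℝ F F) =
        ContinuousLinearMap.id ℝ F :=
      (hasFDerivAt_fst_slot dH).unique ((hasFDerivAt_id z.2).congr_of_eventuallyEq eH)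
    rw [a5, (hasFDerivAt_snd_slot dH).fderiv]
    refine Prod.ext rfl ?_
    have a7 : ∀ s t : F, fderiv ℝ mH (z.2, M.unitH) (s, t) = s +
        fderiv ℝ mH (z.2, M.unitH) (0, t) := by
      intro s t
      have e : ((s, t) : F × F) = (s, 0) + (0, t) := by simp
      rw [e, map_add]
      exact congrArg (· + _) (congrArg (fun L : F →L[ℝ] F => L s) a6)
    exact a7 _ _
  have dG := HasFDerivAt.comp c (f := Prod.fst) (hasFDerivAt_fderiv_snd_slot hmG)
    (hasFDerivAt_fst (𝕜 := ℝ))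
  have dρ := (HasFDerivAt.comp c (f := Prod.snd) (hasFDerivAt_fderiv_snd_slot M.contDiffAt_ρInChart)
    (hasFDerivAt_snd (𝕜 := ℝ))).clm_apply (hasFDerivAt_const w.1 c)
  have dσ := (HasFDerivAt.comp c (f := Prod.snd) (hasFDerivAt_fderiv_snd_slot M.contDiffAt_σInChart)
    (hasFDerivAt_snd (𝕜 := ℝ))).clm_apply (hasFDerivAt_const w.1 c)
  have dH := (HasFDerivAt.comp c (f := Prod.snd) (hasFDerivAt_fderiv_snd_slot hmH)
    (hasFDerivAt_snd (𝕜 := ℝ))).clm_apply (hasFDerivAt_const w.2 c)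
  have h3 := (dG.clm_apply dρ).prodMk (dσ.add dH)
  have h4 := h1.unique (h3.congr_of_eventuallyEq h2)
  have h5 := congrArg (fun L : E × F →L[ℝ] E × F => L v) h4
  have i1 : fderiv ℝ (fun x => mG (M.unitG, x)) M.unitG = ContinuousLinearMap.id ℝ E :=
    ((hasFDerivAt_id M.unitG).congr_of_eventuallyEq (mulInChart_unit_left 𝓘(ℝ, E) G)).fderiv
  have i2 : fderiv ℝ (fun x => M.ρInChart (M.unitH, x)) M.unitG = ContinuousLinearMap.id ℝ E :=
    ((hasFDerivAt_id M.unitG).congr_of_eventuallyEq M.ρInChart_unitH).fderiv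
  rw [e1, lieρ_eq_crossDeriv, lieσ_eq_crossDeriv]
  simp only [c, i1, i2, ContinuousLinearMap.comp_zero, zero_add, ContinuousLinearMap.flip_apply,
    ContinuousLinearMap.comp_apply, add_apply, Function.comp_apply, ContinuousLinearMap.prod_apply,
    ContinuousLinearMap.id_apply, ContinuousLinearMap.coe_fst', ContinuousLinearMap.coe_snd'] at h5
  refine h5.trans (Prod.ext ?_ rfl)
  exact add_comm _ _

/-- The Lie bracket of the matched pair Lie algebra is the Lie bracket of `G ⋈ H`. -/
theorem bracket_eq_lieBilin (x y : E × F) :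
    M.bracket x y = lieBilin M.model M.Bowtie x y := by
  have h : lieBilin M.model M.Bowtie x y =
    mulCross M.model M.Bowtie x y - mulCross M.model M.Bowtie y x := rfl
  rw [h, mulCross_bowtie, mulCross_bowtie, bracket, bracketG, bracketH, bracket_eq_mulCross_sub,
    bracket_eq_mulCross_sub]
  refine Prod.ext ?_ ?_ <;> simp only [Prod.fst_sub, Prod.snd_sub] <;> abel

end MatchedPair

/-! ### The Poisson bracket on the cotangent bundle of a matched pair group -/

namespace MatchedPair

variable {E F : Type*} [NormedAddCommGroup E] [NormedSpace ℝ E]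
  [NormedAddCommGroup F] [NormedSpace ℝ F]
  {G : Type*} [TopologicalSpace G] [ChartedSpace E G] [Group G] [LieGroup 𝓘(ℝ, E) ∞ G]
  {H : Type*} [TopologicalSpace H] [ChartedSpace F H] [Group H] [LieGroup 𝓘(ℝ, F) ∞ H]
  (M : MatchedPair (E := E) (F := F) G H)

/-- The choice defining `coad` succeeds because y ↦ [x, y] is linear and continuous, being the
bracket of the Lie group G ⋈ H. -/
lemma coad_apply (x y : E × F) (α : StrongDual ℝ (E × F)) :
    M.coad x α y = -α (M.bracket x y) := by
  have h : ∃ β : StrongDual ℝ (E × F), ∀ y, β y = -α (M.bracket x y) :=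
    ⟨-(α.comp (lieBilin M.model M.Bowtie x)), fun y => by rw [bracket_eq_lieBilin]; rfl⟩
  exact Classical.epsilon_spec h y

/-- The tangent map at the unit of a right translation of `G ⋈ H`. -/
lemma tangentRight_bowtie (g : G) (h : H) (ξ : E) (η : F) :
    tangentRight M.model (M.elt g h) (ξ, η) =
      (tangentRight 𝓘(ℝ, E) g ξ + M.tangentρ g η, tangentRight 𝓘(ℝ, F) h (M.actσ g η)) := by
  let R : G × H → G × H := fun x => (x.1 * M.ρ x.2 g, M.σ x.2 g * h)
  have hR : MDifferentiableAt M.model M.model R (1, 1) :=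
    (contMDiff_mul_right (I := M.model) (n := ∞) (a := M.elt g h)).mdifferentiableAt
      (x := (1 : M.Bowtie)) (by simp)
  have h1 : tangentRight M.model (M.elt g h) (ξ, η) =
      (mfderiv 𝓘(ℝ, E) M.model (fun a => R (a, 1)) 1 ξ : E × F) +
        mfderiv 𝓘(ℝ, F) M.model (fun b => R (1, b)) 1 η :=
    mfderiv_prodMk_apply hR ξ η
  -- Along G the H-component is 1, which acts trivially and is fixed by G; hence only right
  -- translation by g is seen.
  have h2 : (mfderiv 𝓘(ℝ, E) M.model (fun a => R (a, 1)) 1 ξ : E × F) =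
      (tangentRight 𝓘(ℝ, E) g ξ, 0) := by
    have e : (fun a => R (a, 1)) = fun a => (a * g, h) := by
      funext a; simp only [R, M.one_ρ, M.one_σ, one_mul]
    refine (mfderiv_congr_apply e 1 ξ).trans ?_
    have d := mfderiv_prodMk (mdiffAt_mul_right 𝓘(ℝ, E) g 1)
      (mdifferentiableAt_const (I := 𝓘(ℝ, E)) (I' := 𝓘(ℝ, F)) (x := (1 : G)) (c := h))
    refine (congrArg (fun L : E →L[ℝ] E × F => L ξ) d).trans (Prod.ext rfl ?_)
    exact congrArg (fun L : E →L[ℝ] F => L ξ) mfderiv_const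
  have h3 : (mfderiv 𝓘(ℝ, F) M.model (fun b => R (1, b)) 1 η : E × F) =
      (M.tangentρ g η, tangentRight 𝓘(ℝ, F) h (M.actσ g η)) := by
    have e : (fun b => R (1, b)) = fun b => (M.ρ b g, M.σ b g * h) := by
      funext a; simp only [R, one_mul]
    refine (mfderiv_congr_apply e 1 η).trans ?_
    have dσ := M.mdifferentiableAt_σ_left 1 g
    have dh := mdiffAt_mul_right 𝓘(ℝ, F) h (M.σ 1 g)
    have d := mfderiv_prodMk (M.mdifferentiableAt_ρ_left 1 g) (dh.comp (1 : H) dσ)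
    refine (congrArg (fun L : F →L[ℝ] E × F => L η) d).trans (Prod.ext rfl ?_)
    refine (mfderiv_comp_apply (1 : H) dh dσ η).trans ?_
    have e' : ∀ x : H, x = 1 → ∀ t : F,
        (mfderiv 𝓘(ℝ, F) 𝓘(ℝ, F) (fun y : H => y * h) x t : F) = tangentRight 𝓘(ℝ, F) h t := by
      rintro _ rfl _; rfl
    exact e' _ (M.one_σ g) _
  exact h1.trans ((congrArg₂ (fun s t : E × F => s + t) h2 h3).trans (by simp))

section Derivatives

variable {f : M.Phase → ℝ} {μ : StrongDual ℝ E} {ν : StrongDual ℝ F} {g : G} {h : H}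

/-- The slices μ' ↦ (μ', ν) and ν' ↦ (μ, ν') are affine, so the chain rule splits the derivative on
(𝔤 ⊕ 𝔥)* into its two partial derivatives; functionals separate points. -/
lemma functionalDeriv_eq (hE : Function.Surjective (inclusionInDoubleDual ℝ E))
    (hF : Function.Surjective (inclusionInDoubleDual ℝ F))
    (hf : MDifferentiableAt M.phaseModel 𝓘(ℝ, ℝ) f (M.pt μ ν g h)) :
    functionalDeriv (fun α => f (α, M.elt g h)) (μ.coprod ν) =
      (M.dμ f μ ν g h, M.dν f μ ν g h) := by
  have hd : DifferentiableAt ℝ (fun α => f (α, M.elt g h)) (μ.coprod ν) :=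
    mdifferentiableAt_iff_differentiableAt.1 (mdifferentiableAt_fst_slot hf)
  have h1 : HasFDerivAt (fun μ' : StrongDual ℝ E => μ'.coprod ν)
      ((ContinuousLinearMap.compL ℝ (E × F) E ℝ).flip (ContinuousLinearMap.fst ℝ E F)) μ := by
    have e : (fun μ' : StrongDual ℝ E => μ'.coprod ν) = fun μ' : StrongDual ℝ E =>
        (ContinuousLinearMap.compL ℝ (E × F) E ℝ).flip (ContinuousLinearMap.fst ℝ E F) μ' +
          ν.comp (ContinuousLinearMap.snd ℝ E F) := by
      funext μ'; ext <;> simp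
    rw [e]
    exact (ContinuousLinearMap.hasFDerivAt _).add_const _
  have h2 : HasFDerivAt (fun ν' : StrongDual ℝ F => μ.coprod ν')
      ((ContinuousLinearMap.compL ℝ (E × F) F ℝ).flip (ContinuousLinearMap.snd ℝ E F)) ν := by
    have e : (fun ν' : StrongDual ℝ F => μ.coprod ν') = fun ν' : StrongDual ℝ F =>
        μ.comp (ContinuousLinearMap.fst ℝ E F) +
        (ContinuousLinearMap.compL ℝ (E × F) F ℝ).flip (ContinuousLinearMap.snd ℝ E F) ν' := by
      funext μ'; ext <;> simp
    rw [e]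
    exact (ContinuousLinearMap.hasFDerivAt _).const_add _
  have d1 := (HasFDerivAt.comp μ (g := fun α => f (α, M.elt g h)) hd.hasFDerivAt h1).fderiv
  have d2 := (HasFDerivAt.comp ν (g := fun α => f (α, M.elt g h)) hd.hasFDerivAt h2).fderiv
  refine (eq_functionalDeriv (surjective_inclusionInDoubleDual_prod hE hF) fun β => ?_).symm
  have e : β = (β.comp (ContinuousLinearMap.inl ℝ E F)).comp (ContinuousLinearMap.fst ℝ E F) +
      (β.comp (ContinuousLinearMap.inr ℝ E F)).comp (ContinuousLinearMap.snd ℝ E F) := by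
    ext <;> simp [← Prod.zero_eq_mk]
  have e1 : β (M.dμ f μ ν g h, M.dν f μ ν g h) =
      (β.comp (ContinuousLinearMap.inl ℝ E F)) (M.dμ f μ ν g h) +
      (β.comp (ContinuousLinearMap.inr ℝ E F)) (M.dν f μ ν g h) := by
    simp [← map_add]
  rw [e1]
  conv_rhs => rw [e, map_add]
  refine congrArg₂ (· + ·) ?_ ?_
  · exact (apply_functionalDeriv hE _ _ _).trans
      (congrArg (fun L : StrongDual ℝ E →L[ℝ] ℝ => L (β.comp (ContinuousLinearMap.inl ℝ E F))) d1)
  · exact (apply_functionalDeriv hF _ _ _).trans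
      (congrArg (fun L : StrongDual ℝ F →L[ℝ] ℝ => L (β.comp (ContinuousLinearMap.inr ℝ E F))) d2)

/-- An 𝔥-direction moves both base components, G through T ρ_g and H through T R_h(η ◁ g). This is
the origin of the δ/δg terms in L and the δ/δh terms in M₁. -/
lemma baseDeriv_tangentRight
    (hf : MDifferentiableAt M.phaseModel 𝓘(ℝ, ℝ) f (M.pt μ ν g h)) (ξ : E) (η : F) :
    baseDeriv M.model f (μ.coprod ν) (M.elt g h) (tangentRight M.model (M.elt g h) (ξ, η)) =
      M.dgR f μ ν g h ξ + M.dgρ f μ ν g h η + M.dhσ f μ ν g h η := by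
  have h1 : MDifferentiableAt M.model 𝓘(ℝ, ℝ) (fun k : G × H => f (μ.coprod ν, k)) (g, h) :=
    mdifferentiableAt_snd_slot hf
  rw [tangentRight_bowtie]
  refine (mfderiv_prodMk_apply h1 _ _).trans ?_
  refine congrArg₂ (fun s t : ℝ => s + t) ?_ rfl
  exact map_add (M.dg f μ ν g h) _ _

/-- The canonical Poisson bracket of the cotangent bundle of `G ⋈ H`. -/
theorem canonicalPoisson_bowtie (hE : Function.Surjective (inclusionInDoubleDual ℝ E))
    (hF : Function.Surjective (inclusionInDoubleDual ℝ F)) {A B : M.Phase → ℝ}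
    (hA : MDifferentiableAt M.phaseModel 𝓘(ℝ, ℝ) A (M.pt μ ν g h))
    (hB : MDifferentiableAt M.phaseModel 𝓘(ℝ, ℝ) B (M.pt μ ν g h)) :
    canonicalPoisson M.model A B (M.pt μ ν g h) =
      (M.dgR A μ ν g h (M.dμ B μ ν g h) - M.dgR B μ ν g h (M.dμ A μ ν g h)
        + μ (M.bracketG (M.dμ A μ ν g h) (M.dμ B μ ν g h)))
      + (M.dgρ A μ ν g h (M.dν B μ ν g h) - M.dgρ B μ ν g h (M.dν A μ ν g h)
        + ν (M.bracketH (M.dν A μ ν g h) (M.dν B μ ν g h)))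
      + (M.dhσ A μ ν g h (M.dν B μ ν g h) - M.dhσ B μ ν g h (M.dν A μ ν g h))
      + (-M.starσ (M.dμ A μ ν g h) ν (M.dν B μ ν g h)
        + M.starσ (M.dμ B μ ν g h) ν (M.dν A μ ν g h))
      + (μ (M.lieρ (M.dν A μ ν g h) (M.dμ B μ ν g h))
        - μ (M.lieρ (M.dν B μ ν g h) (M.dμ A μ ν g h))) := by
  refine (canonicalPoisson_eq M.model (surjective_inclusionInDoubleDual_prod hE hF) hA hB).trans ?_
  rw [M.functionalDeriv_eq hE hF hA, M.functionalDeriv_eq hE hF hB, baseDeriv_tangentRight _ hA,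
    baseDeriv_tangentRight _ hB, ← bracket_eq_lieBilin]
  simp only [bracket, ContinuousLinearMap.coprod_apply, map_add, map_sub, starσ]
  ring

end Derivatives

/-! ### Functions pulled back along the projection to 𝔥* ⋊ G -/

lemma νOf_pt (μ : StrongDual ℝ E) (ν : StrongDual ℝ F) (g : G) (h : H) :
    M.νOf (M.pt μ ν g h) = ν := by
  ext η; simp [νOf, pt]

lemma gOf_pt (μ : StrongDual ℝ E) (ν : StrongDual ℝ F) (g : G) (h : H) :
    M.gOf (M.pt μ ν g h) = g := rfl

lemma mdifferentiableAt_pt {VA : Type*} [NormedAddCommGroup VA] [NormedSpace ℝ VA] {SA : Type*}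
    [TopologicalSpace SA] {IA : ModelWithCorners ℝ VA SA} {A : Type*} [TopologicalSpace A]
    [ChartedSpace SA A] {μ : A → StrongDual ℝ E} {ν : A → StrongDual ℝ F} {g : A → G} {a : A}
    (h : H) (hμ : MDifferentiableAt IA 𝓘(ℝ, StrongDual ℝ E) μ a)
    (hν : MDifferentiableAt IA 𝓘(ℝ, StrongDual ℝ F) ν a)
    (hg : MDifferentiableAt IA 𝓘(ℝ, E) g a) :
    MDifferentiableAt IA M.phaseModel (fun x => M.pt (μ x) (ν x) (g x) h) a := by
  have h1 : MDifferentiableAt IA 𝓘(ℝ, StrongDual ℝ (E × F)) (fun x => (μ x).coprod (ν x)) a := by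
    let L : StrongDual ℝ E × StrongDual ℝ F →L[ℝ] StrongDual ℝ (E × F) :=
      (((ContinuousLinearMap.compL ℝ (E × F) E ℝ).flip (ContinuousLinearMap.fst ℝ E F)).coprod
        ((ContinuousLinearMap.compL ℝ (E × F) F ℝ).flip (ContinuousLinearMap.snd ℝ E F)))
    have e : (fun x => (μ x).coprod (ν x)) = L ∘ fun x => (μ x, ν x) := by
      funext x; ext <;> simp [L]
    rw [e]
    exact L.differentiableAt.mdifferentiableAt.comp a (hμ.prodMk_space hν)
  have h2 : MDifferentiableAt IA M.model (fun x => ((g x, h) : G × H)) a :=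
    hg.prodMk mdifferentiableAt_const
  exact h1.prodMk h2

lemma mdifferentiableAt_νOf (q : M.Phase) :
    MDifferentiableAt M.phaseModel 𝓘(ℝ, StrongDual ℝ F) M.νOf q :=
  MDifferentiableAt.comp q
    (g := fun α : StrongDual ℝ (E × F) => α.comp (ContinuousLinearMap.inr ℝ E F))
    (((ContinuousLinearMap.compL ℝ F (E × F) ℝ).flip
      (ContinuousLinearMap.inr ℝ E F)).differentiableAt.mdifferentiableAt) mdifferentiableAt_fst

lemma mdifferentiableAt_gOf (q : M.Phase) :
    MDifferentiableAt M.phaseModel 𝓘(ℝ, E) M.gOf q :=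
  MDifferentiableAt.comp q (g := fun k : G × H => k.1) (I' := M.model) mdifferentiableAt_fst
    mdifferentiableAt_snd

/-- This and the next two lemmas remove the terms containing δ/δμ for functions that do not depend
on μ. -/
lemma lieρ_zero_right (η : F) : M.lieρ η 0 = 0 := by rw [lieρ_eq_crossDeriv, map_zero]

lemma lieσ_zero_right (η : F) : M.lieσ η 0 = 0 := by rw [lieσ_eq_crossDeriv, map_zero]

lemma bracketG_zero_right (ξ : E) : M.bracketG ξ 0 = 0 := by
  rw [bracketG, _root_.bracket_eq_lieBilin, map_zero]

end MatchedPair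

lemma functionalDeriv_const {V : Type*} [NormedAddCommGroup V] [NormedSpace ℝ V]
    (hV : Function.Surjective (inclusionInDoubleDual ℝ V)) (c : ℝ) (μ : StrongDual ℝ V) :
    functionalDeriv (fun _ => c) μ = (0 : V) :=
  (eq_functionalDeriv hV fun β => by simp).symm

end

theorem mainTheorem3
    {E F : Type*} [NormedAddCommGroup E] [NormedSpace ℝ E] [CompleteSpace E]
    [NormedAddCommGroup F] [NormedSpace ℝ F] [CompleteSpace F]
    (hE : Function.Surjective (inclusionInDoubleDual ℝ E))
    (hF : Function.Surjective (inclusionInDoubleDual ℝ F))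
    {G : Type*} [TopologicalSpace G] [ChartedSpace E G] [Group G] [LieGroup 𝓘(ℝ, E) ∞ G]
    {H : Type*} [TopologicalSpace H] [ChartedSpace F H] [Group H] [LieGroup 𝓘(ℝ, F) ∞ H]
    (M : MatchedPair (E := E) (F := F) G H) :
    -- the form is (strongly) nondegenerate, so that Hamiltonian vector fields exist and are unique
    (∀ (p : M.Phase) (l : TangentSpace M.phaseModel p →L[ℝ] ℝ),
      ∃! X : TangentSpace M.phaseModel p, ∀ w, canonicalTwoForm M.model p X w = l w) ∧
    -- the values of the symplectic form on right invariant vector fields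
    (∀ (p : M.Phase) (μ₁ μ₂ : StrongDual ℝ E) (ν₁ ν₂ : StrongDual ℝ F) (ξ₁ ξ₂ : E) (η₁ η₂ : F),
      canonicalTwoForm M.model p
          (M.rightInvariant μ₁ ν₁ ξ₁ η₁ p) (M.rightInvariant μ₂ ν₂ ξ₂ η₂ p) =
        (μ₂ ξ₁ + ν₂ η₁) - (μ₁ ξ₂ + ν₁ η₂) + p.1 (M.bracket (ξ₁, η₁) (ξ₂, η₂))) ∧
    -- the Poisson bracket
    (∀ (A B : M.Phase → ℝ) (μ : StrongDual ℝ E) (ν : StrongDual ℝ F) (g : G) (h : H),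
      MDifferentiableAt M.phaseModel 𝓘(ℝ, ℝ) A (M.pt μ ν g h) →
      MDifferentiableAt M.phaseModel 𝓘(ℝ, ℝ) B (M.pt μ ν g h) →
      canonicalPoisson M.model A B (M.pt μ ν g h) =
          -- canonical bracket on `𝔤^* ⋊ G`
          (M.dgR A μ ν g h (M.dμ B μ ν g h) - M.dgR B μ ν g h (M.dμ A μ ν g h)
            + μ (M.bracketG (M.dμ A μ ν g h) (M.dμ B μ ν g h)))
          -- bracket on `𝔥^* ⋊ G`
          + (M.dgρ A μ ν g h (M.dν B μ ν g h) - M.dgρ B μ ν g h (M.dν A μ ν g h)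
            + ν (M.bracketH (M.dν A μ ν g h) (M.dν B μ ν g h)))
          -- action of `G` on `T^* H`
          + (M.dhσ A μ ν g h (M.dν B μ ν g h) - M.dhσ B μ ν g h (M.dν A μ ν g h))
          -- action of `𝔤` on `𝔥^*`, with `⟨ξ ▷^* ν, η⟩ = ⟨ν, η ◁ ξ⟩`
          + (-M.starσ (M.dμ A μ ν g h) ν (M.dν B μ ν g h)
            + M.starσ (M.dμ B μ ν g h) ν (M.dν A μ ν g h))
          -- action of `𝔥` on `𝔤^*`
          + (μ (M.lieρ (M.dν A μ ν g h) (M.dμ B μ ν g h))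
            - μ (M.lieρ (M.dν B μ ν g h) (M.dμ A μ ν g h))) ∧
      -- the first group of terms is the canonical Poisson bracket on `𝔤^* ⋊ G` of the functions
      -- obtained by freezing `ν` and `h`
      canonicalPoisson 𝓘(ℝ, E) (fun q : StrongDual ℝ E × G => A (M.pt q.1 ν q.2 h))
          (fun q : StrongDual ℝ E × G => B (M.pt q.1 ν q.2 h)) (μ, g) =
        M.dgR A μ ν g h (M.dμ B μ ν g h) - M.dgR B μ ν g h (M.dμ A μ ν g h)
          + μ (M.bracketG (M.dμ A μ ν g h) (M.dμ B μ ν g h)) ∧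
      -- the second group of terms is the Poisson bracket on `𝔥^* ⋊ G` (the one induced through the
      -- projection `(μ, ν, g, h) ↦ (ν, g)`) of the functions obtained by freezing `μ` and `h`
      canonicalPoisson M.model (fun q => A (M.pt μ (M.νOf q) (M.gOf q) h))
          (fun q => B (M.pt μ (M.νOf q) (M.gOf q) h)) (M.pt μ ν g h) =
        M.dgρ A μ ν g h (M.dν B μ ν g h) - M.dgρ B μ ν g h (M.dν A μ ν g h)
          + ν (M.bracketH (M.dν A μ ν g h) (M.dν B μ ν g h))) := by

  refine ⟨fun p l => existsUnique_canonicalTwoForm_eq M.model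
    (surjective_inclusionInDoubleDual_prod hE hF) p l, ?_, ?_⟩
  · intro p μ₁ μ₂ ν₁ ν₂ ξ₁ ξ₂ η₁ η₂
    -- The two coadjoint terms add 2⟨α, [x₁, x₂]⟩ to the -⟨α, [x₁, x₂]⟩ of the symplectic form,
    -- which explains the plus sign in the result.
    refine (canonicalTwoForm_tangentRight M.model p _ _ (ξ₁, η₁) (ξ₂, η₂)).trans ?_
    rw [← M.bracket_eq_lieBilin, add_apply, add_apply, M.coad_apply, M.coad_apply,
      M.bracket_eq_lieBilin (ξ₂, η₂), lieBilin_swap, ← M.bracket_eq_lieBilin, map_neg,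
      ContinuousLinearMap.coprod_apply, ContinuousLinearMap.coprod_apply]
    ring
  · intro A B μ ν g h hA hB
    refine ⟨M.canonicalPoisson_bowtie hE hF hA hB, ?_, ?_⟩
    · have hd : ∀ C : M.Phase → ℝ, MDifferentiableAt M.phaseModel 𝓘(ℝ, ℝ) C (M.pt μ ν g h) →
          MDifferentiableAt (cotangentModel 𝓘(ℝ, E)) 𝓘(ℝ, ℝ)
            (fun q : StrongDual ℝ E × G => C (M.pt q.1 ν q.2 h)) (μ, g) := fun C hC =>
        MDifferentiableAt.comp (μ, g) (g := C) hC (M.mdifferentiableAt_pt h mdifferentiableAt_fst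
          mdifferentiableAt_const mdifferentiableAt_snd)
      refine (canonicalPoisson_eq 𝓘(ℝ, E) hE (hd A hA) (hd B hB)).trans ?_
      -- The three-term formula for the group G alone is already K, since freezing ν and h leaves
      -- the partial derivatives in μ and g unchanged.
      rw [← bracket_eq_lieBilin]
      rfl
    · have hd : ∀ C : M.Phase → ℝ, MDifferentiableAt M.phaseModel 𝓘(ℝ, ℝ) C (M.pt μ ν g h) →
          MDifferentiableAt M.phaseModel 𝓘(ℝ, ℝ)
            (fun q : M.Phase => C (M.pt μ (M.νOf q) (M.gOf q) h)) (M.pt μ ν g h) := by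
        intro C hC
        refine MDifferentiableAt.comp (M.pt μ ν g h) (g := C)
          (f := fun q : M.Phase => M.pt μ (M.νOf q) (M.gOf q) h) ?_
          (M.mdifferentiableAt_pt h mdifferentiableAt_const (M.mdifferentiableAt_νOf _)
            (M.mdifferentiableAt_gOf _))
        rwa [M.νOf_pt, M.gOf_pt]
      -- A pulled-back function is constant in μ and h and agrees with C along the slices in ν and
      -- g.
      have h0 : ∀ C : M.Phase → ℝ,
          M.dμ (fun q => C (M.pt μ (M.νOf q) (M.gOf q) h)) μ ν g h = 0 ∧
          M.dν (fun q => C (M.pt μ (M.νOf q) (M.gOf q) h)) μ ν g h = M.dν C μ ν g h ∧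
          M.dgρ (fun q => C (M.pt μ (M.νOf q) (M.gOf q) h)) μ ν g h = M.dgρ C μ ν g h ∧
          M.dhσ (fun q => C (M.pt μ (M.νOf q) (M.gOf q) h)) μ ν g h = 0 := by
        intro C
        refine ⟨?_, ?_, ?_, ?_⟩
        · simp only [MatchedPair.dμ, M.νOf_pt, M.gOf_pt]
          exact functionalDeriv_const hE _ _
        · simp only [MatchedPair.dν, M.νOf_pt, M.gOf_pt]
        · have e : (fun g' => C (M.pt μ (M.νOf (M.pt μ ν g' h)) (M.gOf (M.pt μ ν g' h)) h)) =
              fun g' => C (M.pt μ ν g' h) := by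
            funext g'; rw [M.νOf_pt, M.gOf_pt]
          exact congrArg (fun L : E →L[ℝ] ℝ => L.comp (M.tangentρ g))
            (ContinuousLinearMap.ext fun v => mfderiv_congr_apply e g v)
        · have e : M.dh (fun q => C (M.pt μ (M.νOf q) (M.gOf q) h)) μ ν g h = 0 := by
            have e : (fun h' => C (M.pt μ (M.νOf (M.pt μ ν g h')) (M.gOf (M.pt μ ν g h')) h)) =
                fun _ => C (M.pt μ ν g h) := by
              funext h'; rw [M.νOf_pt, M.gOf_pt]
            exact ContinuousLinearMap.ext fun v => (mfderiv_congr_apply e h v).trans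
              (congrArg (fun L : F →L[ℝ] ℝ => L v) mfderiv_const)
          rw [MatchedPair.dhσ, MatchedPair.dhR, e, ContinuousLinearMap.zero_comp,
            ContinuousLinearMap.zero_comp]
      refine (M.canonicalPoisson_bowtie hE hF (hd A hA) (hd B hB)).trans ?_
      obtain ⟨a1, a2, a3, a4⟩ := h0 A
      obtain ⟨b1, b2, b3, b4⟩ := h0 B
      -- With δ/δμ and δ/δh equal to zero, K, M₁, M₂ and N vanish and L alone is left.
      simp only [a1, a2, a3, a4, b1, b2, b3, b4, MatchedPair.starσ, M.lieρ_zero_right,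
        M.lieσ_zero_right, M.bracketG_zero_right, map_zero, zero_apply]
      ring
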